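/- Let $S$ be a symmetric real $d\times d$ matrix of full rank with $m\in\{0,\dots,d\}$ positive eigenvalues, and put $S(x,y)=\sum_{i,j}x^iS_{ij}y^j$ for $x,y\in\mathbb{R}^d$. Let $Y$ be an $\mathbb{R}^d$-valued random variable with finite second moment on a probability space $(\Omega,\mathcal F,\mathbb P)$, and let $\nu=\mathrm{law}(Y)$. All relations between random variables are understood almost surely; in particular, "$X$ is $Y$-measurable" means $X=f(Y)$ a.s. for some Borel function $f$. An optimal map is a maximizer of $\frac12\mathbb E[S(X,Y)]$ over all $Y$-measurable $X\in\mathcal L_2(\mathbb R^d)$ with $\mathbb E[Y\mid X]=X$. An optimal plan is a maximizer of $\frac12\int S(x,y)\,d\gamma$ over the set $\Gamma(\nu)$ of all Borel probability measures $\gamma(dx,dy)$ on $\mathbb R^d\times\mathbb R^d$ with finite second moment, with second marginal $\nu$ and with $\gamma(y\mid x)=x$, that is, the $\gamma$-conditional expectation of $y$ given $x$ equals $x$. A set $G\subset\mathbb R^d$ is $S$-monotone if $S(x-y,x-y)\ge 0$ for all $x,y\in G$, and maximal $S$-monotone if it is not a strict subset of another $S$-monotone set. For such a maximal set $G$ define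 $$\psi_G(y)=\sup_{x\in G}\Bigl(S(x,y)-\tfrac12S(x,x)\Bigr)\in(-\infty,+\infty],\qquad P_G(y)=\operatorname*{arg\,min}_{x\in G}S(x-y,x-y),\qquad y\in\mathbb R^d,$$ and let $\Sigma_1(P_G)$ be the set of those $y$ for which there are $y_1,y_2\in P_G(y)$ with $S(y_1-y_2,y_1-y_2)>0$. Let $\sigma(P_G)$ be the $\sigma$-algebra on $\mathbb R^d$ generated by the sets $\{y: P_G(y)\cap U\neq\emptyset\}$, $U\subset\mathbb R^d$ open, and let $\sigma(P_G(Y))=\{Y^{-1}(A): A\in\sigma(P_G)\}$. Suppose that $G$ is a dual optimal set, that is, it minimizes $\int\psi_G\,d\nu$ over all maximal $S$-monotone sets $G$, and that $\nu(\Sigma_1(P_G))=0$. Then $$X:=\mathbb E[Y\mid\sigma(P_G(Y))]$$ is an optimal map and the law of $(X,Y)$ is an optimal plan. If $Z\in\mathcal L_2(\mathbb R^d)$ and the law of $(Z,Y)$ is an optimal plan (in particular, if $Z$ is an optimal map), then $$Z\in P_G(Z)=P_G(Y),$$ $X$ is $Z$-measurable, $X=\mathbb E[Z\mid X]$, and $S(Z-X,Z-X)=0$.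 -/

import Mathlib

open MeasureTheory ProbabilityTheory Set
open scoped ENNReal

namespace BackwardTransport

/-- Euclidean space `ℝ^d`. -/
abbrev Rd (d : ℕ) : Type := EuclideanSpace ℝ (Fin d)

/-- Symmetric `d × d` real matrices of full rank with exactly `m` positive eigenvalues
(counted with multiplicity). -/
def SymIndex (d m : ℕ) : Set (Matrix (Fin d) (Fin d) ℝ) :=
  {S | S.IsSymm ∧ S.rank = d ∧
    ∃ h : S.IsHermitian, (Finset.univ.filter (fun i => 0 < h.eigenvalues i)).card = m}

/-- The scalar product `S(x, y) = ⟨x, S y⟩` of the `S`-space. -/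
def sForm {d : ℕ} (S : Matrix (Fin d) (Fin d) ℝ) (x y : Rd d) : ℝ :=
  ∑ i, ∑ j, x i * S i j * y j

/-- `S`-monotone sets. -/
def SMonotone {d : ℕ} (S : Matrix (Fin d) (Fin d) ℝ) (G : Set (Rd d)) : Prop :=
  ∀ x ∈ G, ∀ y ∈ G, 0 ≤ sForm S (x - y) (x - y)

/-- The family of maximal `S`-monotone sets (maximal with respect to inclusion). -/
def MaxSMonotone {d : ℕ} (S : Matrix (Fin d) (Fin d) ℝ) : Set (Set (Rd d)) :=
  {G | Maximal (SMonotone S) G}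

/-- The Fitzpatrick function `ψ_G(y) = sup_{x ∈ G} (S(x,y) - S(x,x)/2)`, which may equal `+∞`. -/
noncomputable def fitzpatrick {d : ℕ} (S : Matrix (Fin d) (Fin d) ℝ) (G : Set (Rd d))
    (y : Rd d) : EReal :=
  ⨆ x ∈ G, ((sForm S x y - 1 / 2 * sForm S x x : ℝ) : EReal)

/-- The projection multifunction `P_G(y) = argmin_{x ∈ G} S(x - y, x - y)`. -/
def proj {d : ℕ} (S : Matrix (Fin d) (Fin d) ℝ) (G : Set (Rd d)) (y : Rd d) : Set (Rd d) :=
  {x | x ∈ G ∧ ∀ z ∈ G, sForm S (x - y) (x - y) ≤ sForm S (z - y) (z - y)}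

/-- The set of singular points of `P_G`: `P_G(y)` is neither empty nor a singleton. -/
def singularSet {d : ℕ} (S : Matrix (Fin d) (Fin d) ℝ) (G : Set (Rd d)) : Set (Rd d) :=
  {y | (proj S G y).Nonempty ∧ ¬ ∃ x, proj S G y = {x}}

/-- The singular set `Σ₁(P_G)`. -/
def singularSetOne {d : ℕ} (S : Matrix (Fin d) (Fin d) ℝ) (G : Set (Rd d)) : Set (Rd d) :=
  {y | y ∈ singularSet S G ∧
    ∃ u ∈ proj S G y, ∃ v ∈ proj S G y, 0 < sForm S (u - v) (u - v)}

/-- The `σ`-algebra `σ(P_G)` on `ℝ^d` generated by the pre-images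
`{y | P_G(y) ∩ U ≠ ∅}` of open sets `U`. -/
abbrev sigmaProj {d : ℕ} (S : Matrix (Fin d) (Fin d) ℝ) (G : Set (Rd d)) :
    MeasurableSpace (Rd d) :=
  MeasurableSpace.generateFrom
    {A | ∃ U : Set (Rd d), IsOpen U ∧ A = {y | (proj S G y ∩ U).Nonempty}}

/-- The `σ`-algebra `σ(P_G(Y)) = {Y⁻¹(A) | A ∈ σ(P_G)}` on the sample space. -/
abbrev sigmaProjOf {d : ℕ} {Ω : Type*} (S : Matrix (Fin d) (Fin d) ℝ) (G : Set (Rd d))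
    (Y : Ω → Rd d) : MeasurableSpace Ω :=
  (sigmaProj S G).comap Y

/-- Extended integral `∫ f⁺ dμ - ∫ f⁻ dμ` of an extended real function. For the Fitzpatrick
function of a maximal `S`-monotone set one has `ψ_G(y) ≥ S(y,y)/2`, so the negative part is
integrable against measures with finite second moment and the difference is never `∞ - ∞`. -/
noncomputable def extIntegral {α : Type*} [MeasurableSpace α] (μ : Measure α)
    (f : α → EReal) : EReal :=
  ((∫⁻ a, (f a).toENNReal ∂μ : ℝ≥0∞) : EReal) - ((∫⁻ a, (-(f a)).toENNReal ∂μ : ℝ≥0∞) : EReal)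

/-- `G` is an optimal set for the dual problem: minimize `∫ ψ_G dν` over maximal
`S`-monotone sets. -/
def IsDualOptimal {d : ℕ} (S : Matrix (Fin d) (Fin d) ℝ) (ν : Measure (Rd d))
    (G : Set (Rd d)) : Prop :=
  G ∈ MaxSMonotone S ∧ ∀ G' ∈ MaxSMonotone S,
    extIntegral ν (fitzpatrick S G) ≤ extIntegral ν (fitzpatrick S G')

/-- `d`-dimensional random variables with finite second moment. -/
def IsL2 {d : ℕ} {Ω : Type*} [MeasurableSpace Ω] (P : Measure Ω) (X : Ω → Rd d) : Prop :=
  Measurable X ∧ MemLp X 2 P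

/-- `X` is `Y`-measurable: `X = f(Y)` almost surely for a Borel function `f`. -/
def IsMeasurableWrt {d : ℕ} {Ω : Type*} [MeasurableSpace Ω] (P : Measure Ω)
    (X Y : Ω → Rd d) : Prop :=
  ∃ f : Rd d → Rd d, Measurable f ∧ X =ᵐ[P] fun ω => f (Y ω)

/-- The `σ`-algebra generated by a random variable. -/
abbrev sigmaOf {d : ℕ} {Ω : Type*} (X : Ω → Rd d) : MeasurableSpace Ω :=
  MeasurableSpace.comap X inferInstance

/-- Backward martingale maps: square integrable, `Y`-measurable `X` with `E[Y | X] = X`. -/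
def mapSet {d : ℕ} {Ω : Type*} [MeasurableSpace Ω] (P : Measure Ω) (Y : Ω → Rd d) :
    Set (Ω → Rd d) :=
  {X | IsL2 P X ∧ IsMeasurableWrt P X Y ∧ P[Y | sigmaOf X] =ᵐ[P] X}

/-- `X` is an optimal map: it maximizes `E[S(X,Y)]/2` over the backward martingale maps. -/
def IsOptimalMap {d : ℕ} {Ω : Type*} [MeasurableSpace Ω] (S : Matrix (Fin d) (Fin d) ℝ)
    (P : Measure Ω) (Y X : Ω → Rd d) : Prop :=
  X ∈ mapSet P Y ∧ ∀ X' ∈ mapSet P Y,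
    1 / 2 * ∫ ω, sForm S (X' ω) (Y ω) ∂P ≤ 1 / 2 * ∫ ω, sForm S (X ω) (Y ω) ∂P

/-- Backward martingale plans `Γ(ν)`: Borel probability measures `γ(dx, dy)` on `ℝ^d × ℝ^d` with
finite second moment, second marginal `ν` and `γ(y | x) = x`. -/
def planSet {d : ℕ} (ν : Measure (Rd d)) : Set (Measure (Rd d × Rd d)) :=
  {γ | IsProbabilityMeasure γ ∧ MemLp (fun p : Rd d × Rd d => p.1) 2 γ ∧
    MemLp (fun p : Rd d × Rd d => p.2) 2 γ ∧ γ.map Prod.snd = ν ∧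
    γ[(fun p : Rd d × Rd d => p.2) | sigmaOf (fun p : Rd d × Rd d => p.1)]
      =ᵐ[γ] fun p => p.1}

/-- `γ` is an optimal plan: it maximizes `∫ S(x,y) dγ / 2` over `Γ(ν)`. -/
def IsOptimalPlan {d : ℕ} (S : Matrix (Fin d) (Fin d) ℝ) (ν : Measure (Rd d))
    (γ : Measure (Rd d × Rd d)) : Prop :=
  γ ∈ planSet ν ∧ ∀ γ' ∈ planSet ν,
    1 / 2 * ∫ p, sForm S p.1 p.2 ∂γ' ≤ 1 / 2 * ∫ p, sForm S p.1 p.2 ∂γ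

/-- The joint law of two random variables. -/
noncomputable def jointLaw {d : ℕ} {Ω : Type*} [MeasurableSpace Ω] (P : Measure Ω)
    (X Y : Ω → Rd d) : Measure (Rd d × Rd d) :=
  P.map fun ω => (X ω, Y ω)

/-! The `σ`-algebra `σ(P_G(Y))` is contained in `σ(Y)`, so that conditioning on it makes sense. -/

theorem continuous_sForm {d : ℕ} (S : Matrix (Fin d) (Fin d) ℝ) {α : Type*} [TopologicalSpace α]
    {f g : α → Rd d} (hf : Continuous f) (hg : Continuous g) :
    Continuous fun a => sForm S (f a) (g a) := by
  unfold sForm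
  fun_prop

theorem isClosed_of_maxSMonotone {d : ℕ} {S : Matrix (Fin d) (Fin d) ℝ} {G : Set (Rd d)}
    (hG : G ∈ MaxSMonotone S) : IsClosed G := by
  have hmono : SMonotone S (closure G) := by
    have hcl : IsClosed {p : Rd d × Rd d | 0 ≤ sForm S (p.1 - p.2) (p.1 - p.2)} :=
      isClosed_le continuous_const (continuous_sForm S (by fun_prop) (by fun_prop))
    have hsub : closure (G ×ˢ G) ⊆ {p : Rd d × Rd d | 0 ≤ sForm S (p.1 - p.2) (p.1 - p.2)} :=
      closure_minimal (fun p hp => hG.1 p.1 hp.1 p.2 hp.2) hcl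
    intro x hx y hy
    have hxy : (x, y) ∈ closure (G ×ˢ G) := by
      rw [closure_prod_eq]
      exact mk_mem_prod hx hy
    have h := hsub hxy
    rw [mem_ofPred_eq] at h
    exact h
  exact isClosed_of_closure_subset (hG.2 hmono subset_closure)

theorem isClosed_graph_proj {d : ℕ} {S : Matrix (Fin d) (Fin d) ℝ} {G : Set (Rd d)}
    (hG : G ∈ MaxSMonotone S) : IsClosed {p : Rd d × Rd d | p.1 ∈ proj S G p.2} := by
  have h : {p : Rd d × Rd d | p.1 ∈ proj S G p.2} = {p | p.1 ∈ G} ∩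
      ⋂ z ∈ G, {p | sForm S (p.1 - p.2) (p.1 - p.2) ≤ sForm S (z - p.2) (z - p.2)} := by
    ext p
    simp [proj]
  rw [h]
  refine ((isClosed_of_maxSMonotone hG).preimage continuous_fst).inter ?_
  refine isClosed_biInter fun z _ => ?_
  exact isClosed_le (continuous_sForm S (by fun_prop) (by fun_prop))
    (continuous_sForm S (by fun_prop) (by fun_prop))

theorem sigmaProj_le {d : ℕ} {S : Matrix (Fin d) (Fin d) ℝ} {G : Set (Rd d)}
    (hG : G ∈ MaxSMonotone S) : sigmaProj S G ≤ (inferInstance : MeasurableSpace (Rd d)) := by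
  refine MeasurableSpace.generateFrom_le ?_
  rintro A ⟨U, hU, rfl⟩
  have hF : IsSigmaCompact U :=
    isSigmaCompact_iff_sigmaCompactSpace.2 (by
      have := hU.locallyCompactSpace
      infer_instance)
  obtain ⟨K, hK, hKU⟩ := hF
  have h : {y | (proj S G y ∩ U).Nonempty} = ⋃ n, Prod.snd '' ({p : Rd d × Rd d |
      p.1 ∈ proj S G p.2} ∩ K n ×ˢ univ) := by
    rw [← hKU]
    ext y
    simp only [Set.Nonempty, mem_inter_iff, mem_iUnion, mem_ofPred_eq, mem_image, mem_prod,
      mem_univ, and_true, Prod.exists, exists_eq_right]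
    constructor
    · rintro ⟨x, hx, n, hn⟩
      exact ⟨n, x, hx, hn⟩
    · rintro ⟨n, x, hx, hn⟩
      exact ⟨x, hx, n, hn⟩
  rw [h]
  refine MeasurableSet.iUnion fun n => IsClosed.measurableSet ?_
  have := isCompact_iff_compactSpace.1 (hK n)
  have h2 : Prod.snd '' ({p : Rd d × Rd d | p.1 ∈ proj S G p.2} ∩ K n ×ˢ univ) =
      Prod.snd '' {q : K n × Rd d | (q.1 : Rd d) ∈ proj S G q.2} := by
    ext y
    simp only [mem_image, mem_inter_iff, mem_ofPred_eq, mem_prod, mem_univ, and_true, Prod.exists,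
      exists_eq_right, Subtype.exists, exists_prop]
    exact exists_congr fun x => and_comm
  rw [h2]
  refine isClosedMap_snd_of_compactSpace _ ?_
  exact (isClosed_graph_proj hG).preimage
    (f := fun q : K n × Rd d => ((q.1 : Rd d), q.2)) (by fun_prop)

theorem sigmaProjOf_le {d : ℕ} {Ω : Type*} {S : Matrix (Fin d) (Fin d) ℝ}
    {G : Set (Rd d)} (hG : G ∈ MaxSMonotone S) (Y : Ω → Rd d) :
    sigmaProjOf S G Y ≤ sigmaOf Y :=
  MeasurableSpace.comap_mono (sigmaProj_le hG)

end BackwardTransport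

/-!
Write `q(x) = S(x, x) / 2`. A backward martingale pair `(Z, Y)`, that is `E[Y | Z] = Z`, has the
value `E[S(Z, Y)] / 2 = E[q(Z)]`.

*Weak duality.* The Fitzpatrick function `ψ_G` of a maximal monotone set is convex, dominates `q`,
and equals `q` only on `G`. Jensen's inequality gives `E[q(Z)] ≤ E[ψ_G(Z)] ≤ E[ψ_G(Y)]`, and equality
forces `Z ∈ G` and then `Z ∈ P_G(Y)` (`IsBackwardPair.integral_quad_le`,
`IsBackwardPair.ae_mem_proj`).

*No duality gap.* The Hahn-Banach theorem, applied to functions of `(x, y)` of quadratic growth and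
the sublinear functional "least `∫ g dν` with `φ(x, y) ≤ g(y) + ⟨h(x), y - x⟩`", together with the
Riesz-Markov-Kakutani theorem, gives a plan whose value is the infimum of `∫ f dν` over convex
`f ≥ q` (`exists_plan_forall_exists_convex_majorant`). Tails are controlled by the convex functions
`(‖x‖² - n² / 2)⁺`. Every such `f` dominates `ψ_G` for some maximal monotone `G`
(`exists_maxSMonotone_fitzpatrick_le`): a minimal convex majorant `g` of `q` is dominated by its
`S`-conjugate, and a Minty-type argument shows that then `{g = q}` is maximal monotone. Hence for
dual optimal `G` the optimal plans exist and are exactly the plans with `x ∈ P_G(y)` almost surely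
(`isOptimalPlan_iff_ae_mem_proj`).

*Structure of optimal plans.* Let `Z ∈ P_G(Y)`. For `x ∈ P_G(Z)` one has `S(x - Z, Z - Y) ≥ 0`, with
zero conditional mean given `Z`, and so `P_G(Z) ⊆ P_G(Y)` (`IsBackwardPair.ae_proj_subset`). Off
`Σ₁(P_G)` the closed set `P_G(Y)` is convex and isotropic, which gives `P_G(Z) = P_G(Y)`. Then the
events of `σ(P_G(Y))` are events of `σ(Z)`, so that
`X = E[Y | σ(P_G(Y))] = E[Z | σ(P_G(Y))]` is an average of points of the convex set `P_G(Y)` and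
belongs to it (`ae_condExp_mem_of_convex`). All claims follow from this.
-/

namespace BackwardTransport

/-! ### The indefinite scalar product -/

section Form

variable {d : ℕ} (S : Matrix (Fin d) (Fin d) ℝ)

theorem sForm_add_left (x y z : Rd d) : sForm S (x + y) z = sForm S x z + sForm S y z := by
  simp [sForm, add_mul, Finset.sum_add_distrib]

theorem sForm_add_right (x y z : Rd d) : sForm S x (y + z) = sForm S x y + sForm S x z := by
  simp [sForm, mul_add, Finset.sum_add_distrib]

theorem sForm_smul_left (c : ℝ) (x y : Rd d) : sForm S (c • x) y = c * sForm S x y := by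
  simp [sForm, Finset.mul_sum, mul_assoc]

theorem sForm_smul_right (c : ℝ) (x y : Rd d) : sForm S x (c • y) = c * sForm S x y := by
  simp [sForm, Finset.mul_sum, mul_left_comm]

theorem sForm_neg_left (x y : Rd d) : sForm S (-x) y = - sForm S x y := by
  simp [sForm]

theorem sForm_sub_left (x y z : Rd d) : sForm S (x - y) z = sForm S x z - sForm S y z := by
  simp [sForm, sub_mul, Finset.sum_sub_distrib]

theorem sForm_sub_right (x y z : Rd d) : sForm S x (y - z) = sForm S x y - sForm S x z := by
  simp [sForm, mul_sub, Finset.sum_sub_distrib]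

variable {S} in
theorem sForm_comm (hS : S.IsSymm) (x y : Rd d) : sForm S x y = sForm S y x := by
  unfold sForm
  rw [Finset.sum_comm]
  refine Finset.sum_congr rfl fun i _ => Finset.sum_congr rfl fun j _ => ?_
  rw [hS.apply i j]
  ring

/-- The quadratic form `S(x, x) / 2`. -/
noncomputable def quad (x : Rd d) : ℝ := 1 / 2 * sForm S x x

theorem sForm_self (x : Rd d) : sForm S x x = 2 * quad S x := by
  unfold quad; ring

theorem continuous_quad : Continuous (quad S) :=
  continuous_const.mul (continuous_sForm S continuous_id continuous_id)

theorem quad_zero : quad S 0 = 0 := by simp [quad, sForm]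

theorem quad_neg (x : Rd d) : quad S (-x) = quad S x := by
  simp [quad, sForm]

theorem quad_smul (c : ℝ) (x : Rd d) : quad S (c • x) = c ^ 2 * quad S x := by
  simp only [quad, sForm_smul_left, sForm_smul_right]; ring

variable {S} in
theorem quad_add (hS : S.IsSymm) (x y : Rd d) :
    quad S (x + y) = quad S x + sForm S x y + quad S y := by
  simp only [quad, sForm_add_left, sForm_add_right, sForm_comm hS y x]; ring

variable {S} in
theorem quad_sub (hS : S.IsSymm) (x y : Rd d) :
    quad S (x - y) = quad S x - sForm S x y + quad S y := by
  simp only [quad, sForm_sub_left, sForm_sub_right, sForm_comm hS y x]; ring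

theorem sForm_eq_inner (x y : Rd d) :
    sForm S x y = inner ℝ x (Matrix.toEuclideanLin S y) := by
  simp only [sForm, PiLp.inner_apply, Matrix.toLpLin_apply, Matrix.mulVec, dotProduct,
    RCLike.inner_apply, conj_trivial, Finset.sum_mul]
  refine Finset.sum_congr rfl fun i _ => Finset.sum_congr rfl fun j _ => ?_
  ring

/-- The form is diagonal in an orthonormal basis of eigenvectors. -/
theorem sForm_eq_sum_eigenvalues {S : Matrix (Fin d) (Fin d) ℝ} (h : S.IsHermitian) (x y : Rd d) :
    sForm S x y = ∑ i, h.eigenvalues i *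
      (inner ℝ (h.eigenvectorBasis i) x * inner ℝ (h.eigenvectorBasis i) y) := by
  have hb : ∀ i, Matrix.toEuclideanLin S (h.eigenvectorBasis i) =
      h.eigenvalues i • h.eigenvectorBasis i := fun i => by
    ext j
    have := congrFun (h.mulVec_eigenvectorBasis i) j
    simpa [Matrix.toLpLin_apply] using this
  conv_lhs => rw [sForm_eq_inner, ← h.eigenvectorBasis.sum_repr' y]
  rw [map_sum, inner_sum]
  refine Finset.sum_congr rfl fun i _ => ?_
  rw [map_smul, hb, inner_smul_right, inner_smul_right,
    real_inner_comm (h.eigenvectorBasis i) x]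
  ring

/-- The polar decomposition of the form: a linear map `J` (the sign of `S`) such that `S(J x, y)`
is a scalar product which dominates `-S` and which `J` preserves. -/
theorem exists_sign {m : ℕ} {S : Matrix (Fin d) (Fin d) ℝ} (hS : S ∈ SymIndex d m) :
    ∃ J : Rd d →ₗ[ℝ] Rd d, (∀ x y, sForm S (J x) y = sForm S (J y) x) ∧
      (∀ x, sForm S (J (J x)) (J x) = sForm S (J x) x) ∧
      (∀ x, - sForm S (J x) x ≤ sForm S x x) ∧
      ∃ c > 0, ∀ x, c * ‖x‖ ^ 2 ≤ sForm S (J x) x := by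
  obtain ⟨-, hrank, h, -⟩ := hS
  have hne : ∀ i, h.eigenvalues i ≠ 0 := by
    intro i hi
    rw [h.rank_eq_card_non_zero_eigs] at hrank
    have : Fintype.card {i // h.eigenvalues i ≠ 0} < Fintype.card (Fin d) :=
      Fintype.card_subtype_lt (x := i) (by simpa using hi)
    rw [hrank, Fintype.card_fin] at this
    exact lt_irrefl _ this
  set b := h.eigenvectorBasis
  set l := h.eigenvalues
  let J : Rd d →ₗ[ℝ] Rd d :=
    ∑ i, (SignType.sign (l i) : ℝ) • (LinearMap.toSpanSingleton ℝ _ (b i) ∘ₗ innerₗ _ (b i))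
  have hJ : ∀ i x, inner ℝ (b i) (J x) = SignType.sign (l i) * inner ℝ (b i) x := fun i x => by
    have : J x = ∑ i, (SignType.sign (l i) * inner ℝ (b i) x : ℝ) • b i := by
      simp [J, mul_smul]
    rw [this, b.orthonormal.inner_right_fintype]
  have hK : ∀ x y, sForm S (J x) y = ∑ i, |l i| * (inner ℝ (b i) x * inner ℝ (b i) y) := by
    intro x y
    rw [sForm_eq_sum_eigenvalues h]
    refine Finset.sum_congr rfl fun i _ => ?_
    rw [hJ, ← sign_mul_self (l i)]
    ring
  refine ⟨J, fun x y => ?_, fun x => ?_, fun x => ?_, ?_⟩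
  · rw [hK, hK]
    exact Finset.sum_congr rfl fun i _ => by ring
  · rw [hK, hK]
    refine Finset.sum_congr rfl fun i _ => ?_
    rw [hJ]
    rcases lt_or_gt_of_ne (hne i) with h0 | h0 <;> simp [h0]
  · rw [hK, sForm_eq_sum_eigenvalues h, ← Finset.sum_neg_distrib]
    refine Finset.sum_le_sum fun i _ => ?_
    rw [← neg_mul]
    exact mul_le_mul_of_nonneg_right (neg_abs_le _) (mul_self_nonneg _)
  · have hex : ∃ c > 0, ∀ i, c ≤ |l i| := by
      rcases isEmpty_or_nonempty (Fin d) with he | he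
      · exact ⟨1, one_pos, fun i => he.elim i⟩
      · obtain ⟨i, hi⟩ := Finite.exists_min fun i => |l i|
        exact ⟨|l i|, abs_pos.2 (hne i), hi⟩
    obtain ⟨c, hc, hcl⟩ := hex
    refine ⟨c, hc, fun x => ?_⟩
    rw [hK, ← b.sum_sq_inner_right x, Finset.mul_sum]
    refine Finset.sum_le_sum fun i _ => ?_
    rw [← sq]
    exact mul_le_mul_of_nonneg_right (hcl i) (sq_nonneg _)

/-- A quadratic bound for the form in the Euclidean norm. -/
theorem exists_abs_sForm_le : ∃ C, 0 ≤ C ∧ ∀ x y : Rd d, |sForm S x y| ≤ C * (‖x‖ * ‖y‖) := by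
  let T := LinearMap.toContinuousLinearMap (Matrix.toEuclideanLin S)
  refine ⟨‖T‖, norm_nonneg _, fun x y => ?_⟩
  rw [sForm_eq_inner]
  refine (abs_real_inner_le_norm _ _).trans ?_
  have : ‖Matrix.toEuclideanLin S y‖ ≤ ‖T‖ * ‖y‖ := T.le_opNorm y
  calc ‖x‖ * ‖Matrix.toEuclideanLin S y‖ ≤ ‖x‖ * (‖T‖ * ‖y‖) := by gcongr
    _ = _ := by ring

end Form

/-! ### Convex majorants of the quadratic form and maximal monotone sets -/

section Representation

variable {d : ℕ} {S : Matrix (Fin d) (Fin d) ℝ}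

/-- A line whose sum with a parabola is nonnegative to the right of `0` has nonnegative slope. -/
theorem nonneg_of_forall_add_sq {c b : ℝ} (h : ∀ t, 0 < t → t < 1 → 0 ≤ t * c + t ^ 2 * b) :
    0 ≤ c := by
  by_contra! hc
  have hb : 0 < |b| + 1 := by positivity
  obtain ⟨t, ht0, ht⟩ : ∃ t, 0 < t ∧ t < min 1 (-c / (|b| + 1)) :=
    exists_between (lt_min one_pos (div_pos (neg_pos.2 hc) hb))
  have h1 := h t ht0 (ht.trans_le (min_le_left _ _))
  have h2 : t * (|b| + 1) < -c := (lt_div_iff₀ hb).1 (ht.trans_le (min_le_right _ _))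
  have h3 : 0 ≤ c + t * b := by
    have : t * c + t ^ 2 * b = t * (c + t * b) := by ring
    rw [this] at h1
    exact nonneg_of_mul_nonneg_right h1 ht0
  nlinarith [le_abs_self b]

/-- Where a convex majorant `g` of the quadratic form touches it, the gradient of the form is a
subgradient of `g`. -/
theorem sForm_sub_quad_le_of_touch (hS : S.IsSymm) {g : Rd d → ℝ} (hg : ConvexOn ℝ univ g)
    (hq : ∀ x, quad S x ≤ g x) {x : Rd d} (hx : g x = quad S x) (y : Rd d) :
    sForm S x y - quad S x ≤ g y := by
  suffices 0 ≤ g y - quad S x - sForm S x (y - x) by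
    rw [sForm_sub_right, sForm_self] at this; linarith
  refine nonneg_of_forall_add_sq (b := - quad S (y - x)) fun t ht0 ht1 => ?_
  have h1 := hg.2 (mem_univ x) (mem_univ y) (sub_nonneg.2 ht1.le) ht0.le (by ring)
  have h2 := hq ((1 - t) • x + t • y)
  have h3 : (1 - t) • x + t • y = x + t • (y - x) := by module
  rw [h3] at h1 h2
  rw [quad_add hS, sForm_smul_right, quad_smul] at h2
  simp only [smul_eq_mul, hx] at h1
  nlinarith

/-- A finite convex function on `ℝ^d` is bounded below by a multiple of `1 + ‖x‖`. -/
theorem exists_linear_lower_bound {g : Rd d → ℝ} (hg : ConvexOn ℝ univ g) :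
    ∃ C, 0 ≤ C ∧ ∀ x, - C * (1 + ‖x‖) ≤ g x := by
  have hc : Continuous g := continuousOn_univ.1 (hg.continuousOn isOpen_univ)
  obtain ⟨C, hC⟩ := (isCompact_closedBall (0 : Rd d) 1).exists_bound_of_continuousOn hc.continuousOn
  have h0 := hC 0 (by simp)
  have hC0 : 0 ≤ C := (norm_nonneg _).trans h0
  refine ⟨2 * C, by positivity, fun x => ?_⟩
  rcases le_or_gt ‖x‖ 1 with hx | hx
  · have := hC x (by simpa using hx)
    have := (abs_le.1 this).1
    nlinarith [norm_nonneg x]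
  · have hx0 : 0 < ‖x‖ := one_pos.trans hx
    have h1 := hg.2 (mem_univ 0) (mem_univ x)
      (sub_nonneg.2 (inv_le_one_of_one_le₀ hx.le)) (inv_nonneg.2 hx0.le) (by ring)
    have h2 := hC (‖x‖⁻¹ • x) (by simp [norm_smul, hx0.ne'])
    simp only [smul_zero, zero_add, smul_eq_mul] at h1
    have h3 := (abs_le.1 h2).1
    have h4 := (abs_le.1 h0).2
    have h5 : ‖x‖ * ‖x‖⁻¹ = 1 := mul_inv_cancel₀ hx0.ne'
    have h6 : -C * ‖x‖ ≤ (‖x‖ - 1) * g 0 + g x := by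
      have := mul_le_mul_of_nonneg_left (h3.trans h1) hx0.le
      have h7 : ‖x‖ * ((1 - ‖x‖⁻¹) * g 0 + ‖x‖⁻¹ * g x) =
        (‖x‖ - ‖x‖ * ‖x‖⁻¹) * g 0 + ‖x‖ * ‖x‖⁻¹ * g x := by ring
      rw [h7, h5] at this
      linarith
    nlinarith

/-- A convex majorant `g` of the quadratic form whose conjugate is also a majorant touches the form
at a point which is `0` or at which the form is negative: the minimizer of `g(y) + S(J y, y) / 2`,
with `J` the sign of `S`. -/
theorem exists_touch_of_conjugate_ge {m : ℕ} (hS : S ∈ SymIndex d m) {g : Rd d → ℝ}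
    (hg : ConvexOn ℝ univ g) (hq : ∀ x, quad S x ≤ g x)
    (hconj : ∀ w a, (∀ y, sForm S w y - g y ≤ a) → quad S w ≤ a) :
    ∃ y, g y = quad S y ∧ (0 ≤ quad S y → y = 0) := by
  obtain ⟨J, hJc, hJJ, hJS, c, hc, hJn⟩ := exists_sign hS
  have hsymm := hS.1
  have hgc : Continuous g := continuousOn_univ.1 (hg.continuousOn isOpen_univ)
  obtain ⟨C, hC0, hC⟩ := exists_linear_lower_bound hg
  have hJcont : Continuous J := J.continuous_of_finiteDimensional
  have hcont : Continuous fun y => g y + 1 / 2 * sForm S (J y) y :=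
    hgc.add (continuous_const.mul (continuous_sForm S hJcont continuous_id))
  obtain ⟨z, hz⟩ := hcont.exists_forall_le' 0 (by
    have hR : ∀ᶠ y : Rd d in Filter.cocompact (Rd d), 1 + 2 / c * (2 * C + |g 0|) ≤ ‖y‖ :=
      tendsto_norm_cocompact_atTop.eventually_ge_atTop _
    filter_upwards [hR] with y hy
    have h0 : sForm S (J 0) 0 = 0 := by simp [sForm]
    have h1 := hC y
    have h2 := hJn y
    have h3 : 0 ≤ 2 / c * (2 * C + |g 0|) := by positivity
    have h4 : c * (2 / c * (2 * C + |g 0|)) = 2 * (2 * C + |g 0|) := by field_simp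
    have h5 : 2 * (2 * C + |g 0|) ≤ c * ‖y‖ := by nlinarith
    have h6 : 1 ≤ ‖y‖ := by linarith
    have h7 := mul_le_mul_of_nonneg_right h5 (norm_nonneg y)
    have h8 := mul_le_mul_of_nonneg_left h6 (abs_nonneg (g 0))
    rw [h0]
    nlinarith [le_abs_self (g 0)])
  have hadd : ∀ u v, sForm S (J (u + v)) (u + v) =
      sForm S (J u) u + 2 * sForm S (J u) v + sForm S (J v) v := fun u v => by
    rw [map_add, sForm_add_left, sForm_add_right, sForm_add_right, hJc v u]; ring
  -- the optimality condition at the minimizer `z`: `-J z` is a subgradient of `g` there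
  have hsub : ∀ y, g z - sForm S (J z) (y - z) ≤ g y := fun y => by
    suffices 0 ≤ g y - g z + sForm S (J z) (y - z) by linarith
    refine nonneg_of_forall_add_sq (b := 1 / 2 * sForm S (J (y - z)) (y - z))
      fun t ht0 ht1 => ?_
    have h1 := hg.2 (mem_univ z) (mem_univ y) (sub_nonneg.2 ht1.le) ht0.le (by ring)
    have h2 := hz ((1 - t) • z + t • y)
    have h3 : (1 - t) • z + t • y = z + t • (y - z) := by module
    rw [h3] at h1 h2
    rw [hadd, map_smul, sForm_smul_left, sForm_smul_right, sForm_smul_right] at h2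
    simp only [smul_eq_mul] at h1
    nlinarith
  have hw := hconj (-(J z)) (-g z - sForm S (J z) z) fun y => by
    have := hsub y
    rw [sForm_sub_right] at this
    rw [sForm_neg_left]
    linarith
  rw [quad_neg] at hw
  have h1 := hJS (J z)
  rw [hJJ, sForm_self] at h1
  have h2 := hJS z
  rw [sForm_self] at h2
  have h3 := hq z
  refine ⟨z, by linarith, fun h => ?_⟩
  have h4 := hJn z
  have h5 : ‖z‖ ^ 2 ≤ 0 := by nlinarith
  simpa using h5

/-- Adjoining to the epigraph of a convex majorant `g` of the form a point `(w, a)` that lies above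
both the form and the conjugate of `g`, and taking the convex hull, gives another convex majorant. -/
theorem exists_convex_majorant_le (hS : S.IsSymm) {g : Rd d → ℝ}
    (hg : ConvexOn ℝ univ g) (hq : ∀ x, quad S x ≤ g x) {w : Rd d} {a : ℝ}
    (ha : ∀ y, sForm S w y - g y ≤ a) (hqa : quad S w ≤ a) :
    ∃ k : Rd d → ℝ, ConvexOn ℝ univ k ∧ (∀ x, quad S x ≤ k x) ∧ (∀ x, k x ≤ g x) ∧ k w ≤ a := by
  let A : Rd d → Set ℝ := fun z =>
    {r | ∃ t y, 0 ≤ t ∧ t ≤ 1 ∧ z = t • w + (1 - t) • y ∧ r = t * a + (1 - t) * g y}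
  have hA : ∀ z, ∀ r ∈ A z, quad S z ≤ r := by
    rintro z r ⟨t, y, ht0, ht1, rfl, rfl⟩
    rw [quad_add hS, quad_smul, quad_smul, sForm_smul_left, sForm_smul_right]
    have h1 := ha y
    have h2 := hq y
    have h3 : 0 ≤ 1 - t := sub_nonneg.2 ht1
    have e1 := mul_le_mul_of_nonneg_left hqa (mul_nonneg ht0 ht0)
    have e2 := mul_le_mul_of_nonneg_left h2 (mul_nonneg h3 h3)
    have e3 := mul_le_mul_of_nonneg_left h1 (mul_nonneg ht0 h3)
    nlinarith
  have hbdd : ∀ z, BddBelow (A z) := fun z => ⟨quad S z, hA z⟩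
  have hgA : ∀ z, g z ∈ A z := fun z => ⟨0, z, le_rfl, zero_le_one, by simp, by simp⟩
  refine ⟨fun z => sInf (A z), ⟨convex_univ, ?_⟩, fun z => le_csInf ⟨_, hgA z⟩ (hA z),
    fun z => csInf_le (hbdd z) (hgA z),
    csInf_le (hbdd w) ⟨1, w, zero_le_one, le_rfl, by simp, by simp⟩⟩
  intro z₁ _ z₂ _ α β hα hβ hαβ
  simp only [smul_eq_mul]
  refine le_of_forall_pos_le_add fun ε hε => ?_
  obtain ⟨r₁, ⟨t₁, y₁, ht₁, ht₁', hz₁, hr₁⟩, h₁⟩ := Real.lt_sInf_add_pos ⟨_, hgA z₁⟩ hε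
  obtain ⟨r₂, ⟨t₂, y₂, ht₂, ht₂', hz₂, hr₂⟩, h₂⟩ := Real.lt_sInf_add_pos ⟨_, hgA z₂⟩ hε
  have key : ∃ r ∈ A (α • z₁ + β • z₂), r ≤ α * r₁ + β * r₂ := by
    have hs₁ : 0 ≤ α * (1 - t₁) := mul_nonneg hα (sub_nonneg.2 ht₁')
    have hs₂ : 0 ≤ β * (1 - t₂) := mul_nonneg hβ (sub_nonneg.2 ht₂')
    have hτ : 1 - (α * t₁ + β * t₂) = α * (1 - t₁) + β * (1 - t₂) := by linarith
    have hτ0 : 0 ≤ α * t₁ + β * t₂ := by positivity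
    rcases (add_nonneg hs₁ hs₂).eq_or_lt with h0 | h0
    · have e1 : α * (1 - t₁) = 0 := by linarith
      have e2 : β * (1 - t₂) = 0 := by linarith
      refine ⟨_, ⟨1, w, zero_le_one, le_rfl, ?_, rfl⟩, ?_⟩
      · have : α • z₁ + β • z₂ = (α * t₁ + β * t₂) • w + (α * (1 - t₁)) • y₁
            + (β * (1 - t₂)) • y₂ := by rw [hz₁, hz₂]; module
        have hτ1 : α * t₁ + β * t₂ = 1 := by linarith
        rw [this, e1, e2, hτ1]; simp
      · have : α * r₁ + β * r₂ = (α * t₁ + β * t₂) * a + (α * (1 - t₁)) * g y₁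
            + (β * (1 - t₂)) * g y₂ := by rw [hr₁, hr₂]; ring
        have hτ1 : α * t₁ + β * t₂ = 1 := by linarith
        rw [this, e1, e2, hτ1]; simp
    · set s := α * (1 - t₁) + β * (1 - t₂) with hs
      have hsum : α * (1 - t₁) / s + β * (1 - t₂) / s = 1 := by
        rw [← add_div, ← hs, div_self h0.ne']
      have hcvx := hg.2 (mem_univ y₁) (mem_univ y₂) (div_nonneg hs₁ h0.le)
        (div_nonneg hs₂ h0.le) hsum
      refine ⟨_, ⟨α * t₁ + β * t₂, (α * (1 - t₁) / s) • y₁ + (β * (1 - t₂) / s) • y₂, hτ0,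
        by linarith, ?_, rfl⟩, ?_⟩
      · rw [hτ, smul_add, smul_smul, smul_smul, mul_div_cancel₀ _ h0.ne',
          mul_div_cancel₀ _ h0.ne', hz₁, hz₂]
        module
      · rw [hτ, hr₁, hr₂]
        have := mul_le_mul_of_nonneg_left hcvx h0.le
        simp only [smul_eq_mul, mul_add, ← mul_assoc, mul_div_cancel₀ _ h0.ne'] at this
        nlinarith
  obtain ⟨r, hr, hrle⟩ := key
  have := csInf_le (hbdd _) hr
  nlinarith [mul_le_mul_of_nonneg_left h₁.le hα, mul_le_mul_of_nonneg_left h₂.le hβ]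

/-- Zorn's lemma for convex majorants of the form. -/
theorem exists_minimal_convex_majorant {f : Rd d → ℝ} (hf : ConvexOn ℝ univ f)
    (hq : ∀ x, quad S x ≤ f x) :
    ∃ g : Rd d → ℝ, ConvexOn ℝ univ g ∧ (∀ x, quad S x ≤ g x) ∧ (∀ x, g x ≤ f x) ∧
      ∀ k : Rd d → ℝ, ConvexOn ℝ univ k → (∀ x, quad S x ≤ k x) → (∀ x, k x ≤ g x) → k = g := by
  let A : Set (Rd d → ℝ)ᵒᵈ :=
    {k | ConvexOn ℝ univ (OrderDual.ofDual k) ∧ ∀ x, quad S x ≤ OrderDual.ofDual k x}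
  have hchain : ∀ c ⊆ A, IsChain (· ≤ ·) c → ∀ k₀ ∈ c, ∃ ub ∈ A, ∀ z ∈ c, z ≤ ub := by
    intro c hcA hc k₀ hk₀
    have : Nonempty c := ⟨⟨k₀, hk₀⟩⟩
    have hbdd : ∀ x, BddBelow (range fun k : c => OrderDual.ofDual k.1 x) := fun x =>
      ⟨quad S x, by rintro _ ⟨k, rfl⟩; exact (hcA k.2).2 x⟩
    refine ⟨OrderDual.toDual fun x => ⨅ k : c, OrderDual.ofDual k.1 x, ⟨⟨convex_univ, ?_⟩, ?_⟩, ?_⟩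
    · intro x _ y _ α β hα hβ hαβ
      simp only [OrderDual.ofDual_toDual, smul_eq_mul]
      refine le_of_forall_pos_le_add fun ε hε => ?_
      obtain ⟨k₁, h₁⟩ := exists_lt_of_ciInf_lt (lt_add_of_pos_right
        (⨅ k : c, OrderDual.ofDual k.1 x) hε)
      obtain ⟨k₂, h₂⟩ := exists_lt_of_ciInf_lt (lt_add_of_pos_right
        (⨅ k : c, OrderDual.ofDual k.1 y) hε)
      obtain ⟨k, hk₁, hk₂⟩ : ∃ k : c, OrderDual.ofDual k.1 ≤ OrderDual.ofDual k₁.1 ∧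
          OrderDual.ofDual k.1 ≤ OrderDual.ofDual k₂.1 := by
        rcases hc.total k₁.2 k₂.2 with h | h
        · exact ⟨k₂, h, le_rfl⟩
        · exact ⟨k₁, le_rfl, h⟩
      refine (ciInf_le (hbdd _) k).trans (((hcA k.2).1.2 (mem_univ x) (mem_univ y) hα hβ
        hαβ).trans ?_)
      have e1 := mul_le_mul_of_nonneg_left ((hk₁ x).trans h₁.le) hα
      have e2 := mul_le_mul_of_nonneg_left ((hk₂ y).trans h₂.le) hβ
      simp only [smul_eq_mul]
      nlinarith
    · exact fun x => le_ciInf fun k => (hcA k.2).2 x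
    · exact fun k hk x => ciInf_le (hbdd x) ⟨k, hk⟩
  obtain ⟨g, hfg, hg⟩ := zorn_le_nonempty₀ A hchain (OrderDual.toDual f) ⟨hf, hq⟩
  refine ⟨OrderDual.ofDual g, hg.1.1, hg.1.2, hfg, fun k hk hqk hkg => ?_⟩
  exact le_antisymm hkg (hg.2 (y := OrderDual.toDual k) ⟨hk, hqk⟩ hkg)

/-- Every finite convex majorant of the quadratic form dominates the Fitzpatrick function of some
maximal monotone set. -/
theorem exists_maxSMonotone_fitzpatrick_le {m : ℕ} (hS : S ∈ SymIndex d m) {f : Rd d → ℝ}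
    (hf : ConvexOn ℝ univ f) (hq : ∀ x, quad S x ≤ f x) :
    ∃ G ∈ MaxSMonotone S, ∀ y, fitzpatrick S G y ≤ (f y : EReal) := by
  have hsymm := hS.1
  obtain ⟨g, hg, hqg, hgf, hmin⟩ := exists_minimal_convex_majorant hf hq
  have hle : ∀ w a, (∀ y, sForm S w y - g y ≤ a) → quad S w ≤ a → g w ≤ a := by
    intro w a ha hqa
    obtain ⟨k, hk, hqk, hkg, hkw⟩ := exists_convex_majorant_le hsymm hg hqg ha hqa
    rwa [← hmin k hk hqk hkg]
  have hconj : ∀ w a, (∀ y, sForm S w y - g y ≤ a) → quad S w ≤ a := by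
    intro w a ha
    by_contra! hlt
    have h1 := hle w (quad S w) (fun y => (ha y).trans hlt.le) le_rfl
    have h2 := ha w
    rw [sForm_self] at h2
    linarith
  have htouch : ∀ x, g x = quad S x → ∀ y, sForm S x y - quad S x ≤ g y := fun x hx =>
    sForm_sub_quad_le_of_touch hsymm hg hqg hx
  refine ⟨{x | g x = quad S x}, ⟨fun x hx y hy => ?_, fun H hH hGH x₀ hx₀ => ?_⟩, fun y => ?_⟩
  · have h := htouch x hx y
    rw [sForm_self, quad_sub hsymm]
    have hy : g y = quad S y := hy
    linarith
  · have hg' : ConvexOn ℝ univ (fun y => g (y + x₀) - sForm S x₀ y - quad S x₀) := by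
      have h1 : ConvexOn ℝ univ fun y => g (y + x₀) := by
        exact hg.translate_left x₀
      refine ⟨convex_univ, fun x hx y hy α β hα hβ hαβ => ?_⟩
      have := h1.2 hx hy hα hβ hαβ
      simp only [smul_eq_mul, sForm_add_right, sForm_smul_right] at this ⊢
      have h3 : quad S x₀ = α * quad S x₀ + β * quad S x₀ := by rw [← add_mul, hαβ, one_mul]
      linarith
    have hqg' : ∀ y, quad S y ≤ g (y + x₀) - sForm S x₀ y - quad S x₀ := by
      intro y
      have := hqg (y + x₀)
      rw [quad_add hsymm, sForm_comm hsymm y x₀] at this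
      linarith
    have hconj' : ∀ w a, (∀ y, sForm S w y - (g (y + x₀) - sForm S x₀ y - quad S x₀) ≤ a) →
        quad S w ≤ a := by
      intro w a ha
      have h1 := hconj (w + x₀) (a + sForm S w x₀ + quad S x₀) fun y => by
        have := ha (y - x₀)
        simp only [sub_add_cancel, sForm_sub_right, sForm_self] at this
        rw [sForm_add_left]
        linarith
      rw [quad_add hsymm] at h1
      linarith
    obtain ⟨y, hy, hy0⟩ := exists_touch_of_conjugate_ge hS
      (g := fun y => g (y + x₀) - sForm S x₀ y - quad S x₀) hg' hqg' hconj'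
    have hyG : g (y + x₀) = quad S (y + x₀) := by
        rw [quad_add hsymm, sForm_comm hsymm y x₀]; linarith
    have h1 := hH _ (hGH hyG) _ hx₀
    rw [add_sub_cancel_right, sForm_self] at h1
    have h2 : y = 0 := hy0 (by linarith)
    rwa [h2, zero_add] at hyG
  · refine iSup₂_le fun x hx => EReal.coe_le_coe_iff.2 ?_
    exact (htouch x hx y).trans (hgf y)

end Representation

/-! ### Duality without gap -/

section Duality

variable {d : ℕ}

/-- A sublinear functional is the maximum of the linear functionals that it dominates. -/
theorem exists_linearMap_eq_le_sublinear {E : Type*} [AddCommGroup E] [Module ℝ E] (N : E → ℝ)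
    (hsmul : ∀ c : ℝ, 0 < c → ∀ x, N (c • x) = c * N x) (hadd : ∀ x y, N (x + y) ≤ N x + N y)
    (x₀ : E) : ∃ L : E →ₗ[ℝ] ℝ, L x₀ = N x₀ ∧ ∀ x, L x ≤ N x := by
  have h0 : N 0 = 0 := by
    have := hsmul 2 two_pos 0
    rw [smul_zero] at this
    linarith
  have H : ∀ c : ℝ, c • x₀ = 0 → c • N x₀ = 0 := fun c hc => by
    rcases smul_eq_zero.1 hc with h | h
    · simp [h]
    · simp [h, h0]
  obtain ⟨L, hL, hLN⟩ := exists_extension_of_le_sublinear (LinearPMap.mkSpanSingleton' x₀ (N x₀) H)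
    N hsmul hadd (by
      rintro ⟨x, hx⟩
      obtain ⟨c, rfl⟩ := Submodule.mem_span_singleton.1 hx
      rw [LinearPMap.mkSpanSingleton'_apply]
      rcases lt_trichotomy c 0 with hc | rfl | hc
      · have h1 := hadd (c • x₀) ((-c) • x₀)
        rw [hsmul (-c) (neg_pos.2 hc), ← add_smul, add_neg_cancel, zero_smul, h0] at h1
        change c * N x₀ ≤ N (c • x₀)
        linarith
      · simp [h0]
      · exact (hsmul c hc x₀).ge)
  refine ⟨L, ?_, hLN⟩
  have := hL ⟨x₀, Submodule.mem_span_singleton_self x₀⟩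
  rw [this]
  exact LinearPMap.mkSpanSingleton'_apply_self x₀ (N x₀) H _

/-- The weight `1 + ‖x‖² + ‖y‖²`. -/
noncomputable def weight (p : Rd d × Rd d) : ℝ := 1 + ‖p.1‖ ^ 2 + ‖p.2‖ ^ 2

theorem one_le_weight (p : Rd d × Rd d) : 1 ≤ weight p := by
  unfold weight; nlinarith [sq_nonneg ‖p.1‖, sq_nonneg ‖p.2‖]

theorem continuous_weight : Continuous (weight (d := d)) := by
  unfold weight; fun_prop

/-- The space of all (not necessarily measurable) functions on `ℝ^d × ℝ^d` of at most quadratic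
growth. -/
def quadGrowth (d : ℕ) : Submodule ℝ (Rd d × Rd d → ℝ) where
  carrier := {φ | ∃ C, ∀ p, |φ p| ≤ C * weight p}
  add_mem' := by
    rintro φ ψ ⟨C, hC⟩ ⟨D, hD⟩
    exact ⟨C + D, fun p => (abs_add_le _ _).trans (by rw [add_mul]; exact add_le_add (hC p) (hD p))⟩
  zero_mem' := ⟨0, fun p => by simp⟩
  smul_mem' := by
    rintro c φ ⟨C, hC⟩
    refine ⟨|c| * C, fun p => ?_⟩
    rw [Pi.smul_apply, smul_eq_mul, abs_mul, mul_assoc]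
    exact mul_le_mul_of_nonneg_left (hC p) (abs_nonneg c)

theorem mem_quadGrowth {φ : Rd d × Rd d → ℝ} (C : ℝ) (h : ∀ p, |φ p| ≤ C * weight p) :
    φ ∈ quadGrowth d := ⟨C, h⟩

theorem mem_quadGrowth_of_bounded {φ : Rd d × Rd d → ℝ} {C : ℝ} (h : ∀ p, |φ p| ≤ C) :
    φ ∈ quadGrowth d :=
  ⟨C, fun p => (h p).trans (le_mul_of_one_le_right ((abs_nonneg _).trans (h p)) (one_le_weight p))⟩

/-- The continuous cut-off function equal to `1` on the ball of radius `n` and to `0` outside of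
the ball of radius `n + 1`. -/
noncomputable def cutoff (n : ℕ) (p : Rd d × Rd d) : ℝ := max 0 (min 1 (n + 1 - ‖p‖))

theorem continuous_cutoff (n : ℕ) : Continuous (cutoff (d := d) n) := by
  unfold cutoff; fun_prop

theorem cutoff_nonneg (n : ℕ) (p : Rd d × Rd d) : 0 ≤ cutoff n p := le_max_left _ _

theorem cutoff_le_one (n : ℕ) (p : Rd d × Rd d) : cutoff n p ≤ 1 :=
  max_le zero_le_one (min_le_left _ _)

theorem cutoff_eq_one {n : ℕ} {p : Rd d × Rd d} (h : ‖p‖ ≤ n) : cutoff n p = 1 := by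
  unfold cutoff
  rw [min_eq_left (by linarith), max_eq_right zero_le_one]

theorem cutoff_eq_zero {n : ℕ} {p : Rd d × Rd d} (h : n + 1 ≤ ‖p‖) : cutoff n p = 0 := by
  unfold cutoff
  exact max_eq_left ((min_le_right _ _).trans (by linarith))

theorem hasCompactSupport_mul_cutoff (φ : Rd d × Rd d → ℝ) (n : ℕ) :
    HasCompactSupport fun p => φ p * cutoff n p := by
  refine HasCompactSupport.intro (isCompact_closedBall (0 : Rd d × Rd d) (n + 1)) fun p hp => ?_
  rw [cutoff_eq_zero, mul_zero]
  simpa using (not_le.1 (by simpa using hp)).le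

/-- A positive linear functional on functions of quadratic growth with small tails is represented,
on continuous functions, by a measure. The tail condition is what the Riesz-Markov-Kakutani theorem
for compactly supported functions does not give. -/
theorem exists_measure_of_tail (L : quadGrowth d →ₗ[ℝ] ℝ)
    (hpos : ∀ φ : quadGrowth d, (∀ p, 0 ≤ φ.1 p) → 0 ≤ L φ) (ε : ℕ → ℝ)
    (hε : Filter.Tendsto ε Filter.atTop (nhds 0))
    (htail : ∀ (n : ℕ) (φ : quadGrowth d), 1 ≤ n → (∀ p, ‖p‖ ≤ n → φ.1 p = 0) →
      (∀ p, |φ.1 p| ≤ weight p) → L φ ≤ ε n) :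
    ∃ γ : Measure (Rd d × Rd d), ∀ φ : quadGrowth d, Continuous φ.1 →
      Integrable φ.1 γ ∧ ∫ p, φ.1 p ∂γ = L φ := by
  have hmono : ∀ φ ψ : quadGrowth d, (∀ p, φ.1 p ≤ ψ.1 p) → L φ ≤ L ψ := fun φ ψ h => by
    have := hpos (ψ - φ) fun p => sub_nonneg.2 (h p)
    rw [map_sub] at this
    linarith
  have hcs : ∀ f : CompactlySupportedContinuousMap (Rd d × Rd d) ℝ, ⇑f ∈ quadGrowth d :=
    fun f => by
      obtain ⟨C, hC⟩ := f.hasCompactSupport.exists_bound_of_continuous f.continuous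
      exact mem_quadGrowth_of_bounded hC
  let Λ₀ : CompactlySupportedContinuousMap (Rd d × Rd d) ℝ →ₗ[ℝ] ℝ :=
    { toFun := fun f => L ⟨f, hcs f⟩
      map_add' := fun f g => by rw [← map_add]; rfl
      map_smul' := fun c f => by
        simp only [RingHom.id_apply]
        rw [← map_smul]; rfl }
  let Λ : CompactlySupportedContinuousMap (Rd d × Rd d) ℝ →ₚ[ℝ] ℝ :=
    PositiveLinearMap.mk₀ Λ₀ fun f hf => hpos _ hf
  let γ := RealRMK.rieszMeasure Λ
  have hγ : ∀ (φ : quadGrowth d) (hφ : Continuous φ.1) (n : ℕ)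
      (hmem : (fun p => φ.1 p * cutoff n p) ∈ quadGrowth d),
      ∫ p, φ.1 p * cutoff n p ∂γ = L ⟨_, hmem⟩ := fun φ hφ n hmem =>
    RealRMK.integral_rieszMeasure Λ
      ⟨⟨fun p => φ.1 p * cutoff n p, hφ.mul (continuous_cutoff n)⟩,
        hasCompactSupport_mul_cutoff _ _⟩
  have hcut : ∀ (φ : quadGrowth d) (n : ℕ), (fun p => φ.1 p * cutoff n p) ∈ quadGrowth d := by
    rintro ⟨φ, C, hC⟩ n
    refine mem_quadGrowth C fun p => ?_
    rw [abs_mul, abs_of_nonneg (cutoff_nonneg n p)]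
    exact (mul_le_of_le_one_right (abs_nonneg _) (cutoff_le_one n p)).trans (hC p)
  let w : quadGrowth d := ⟨weight, mem_quadGrowth 1 fun p => by
    rw [one_mul, abs_of_nonneg (zero_le_one.trans (one_le_weight p))]⟩
  have hw0 : ∀ p : Rd d × Rd d, 0 ≤ weight p := fun p => zero_le_one.trans (one_le_weight p)
  have hwint : Integrable (weight (d := d)) γ := by
    have hcover : AECover γ Filter.atTop fun n : ℕ => Metric.closedBall (0 : Rd d × Rd d) n :=
      aecover_closedBall tendsto_natCast_atTop_atTop
    refine hcover.integrable_of_integral_norm_bounded (L w) (fun n => ?_)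
      (Filter.Eventually.of_forall fun n => ?_)
    · exact continuous_weight.continuousOn.integrableOn_compact (isCompact_closedBall _ _)
    · have hint : Integrable (fun p => weight p * cutoff n p) γ :=
        (continuous_weight.mul (continuous_cutoff n)).integrable_of_hasCompactSupport
          (hasCompactSupport_mul_cutoff _ _)
      have h1 : ∫ p in Metric.closedBall (0 : Rd d × Rd d) n, ‖weight p‖ ∂γ =
          ∫ p in Metric.closedBall (0 : Rd d × Rd d) n, weight p * cutoff n p ∂γ := by
        refine setIntegral_congr_fun Metric.isClosed_closedBall.measurableSet fun p hp => ?_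
        simp only [Real.norm_eq_abs]
        rw [cutoff_eq_one (by simpa using hp), mul_one, abs_of_nonneg (hw0 p)]
      rw [h1]
      refine (setIntegral_le_integral hint (Filter.Eventually.of_forall fun p =>
        mul_nonneg (hw0 p) (cutoff_nonneg n p))).trans ?_
      rw [hγ w continuous_weight n (hcut w n)]
      exact hmono _ _ fun p => mul_le_of_le_one_right (hw0 p) (cutoff_le_one n p)
  refine ⟨γ, fun φ hφ => ?_⟩
  obtain ⟨C, hC⟩ := φ.2
  have hint : Integrable φ.1 γ :=
    (hwint.const_mul C).mono' hφ.aestronglyMeasurable (Filter.Eventually.of_forall hC)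
  refine ⟨hint, ?_⟩
  have hlim : Filter.Tendsto (fun n : ℕ => ∫ p, φ.1 p * cutoff n p ∂γ) Filter.atTop
      (nhds (∫ p, φ.1 p ∂γ)) := by
    refine tendsto_integral_of_dominated_convergence (fun p => C * weight p)
      (fun n => (hφ.mul (continuous_cutoff n)).aestronglyMeasurable) (hwint.const_mul C)
      (fun n => Filter.Eventually.of_forall fun p => ?_) (Filter.Eventually.of_forall fun p => ?_)
    · rw [norm_mul, Real.norm_eq_abs, Real.norm_eq_abs, abs_of_nonneg (cutoff_nonneg n p)]
      exact (mul_le_of_le_one_right (abs_nonneg _) (cutoff_le_one n p)).trans (hC p)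
    · refine tendsto_const_nhds.congr' ?_
      filter_upwards [Filter.eventually_ge_atTop ⌈‖p‖⌉₊] with n hn
      rw [cutoff_eq_one (Nat.ceil_le.1 hn), mul_one]
  refine tendsto_nhds_unique hlim ?_
  rw [tendsto_iff_dist_tendsto_zero]
  -- the difference of `φ` and its cut-off, scaled to be bounded by the weight
  have hC' : 0 < |C| + 1 := by positivity
  have hdist : ∀ n : ℕ, 1 ≤ n → dist (∫ p, φ.1 p * cutoff n p ∂γ) (L φ) ≤ (|C| + 1) * ε n := by
    intro n hn
    rw [hγ φ hφ n (hcut φ n), Real.dist_eq, ← map_sub]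
    set ψ : quadGrowth d := ⟨_, hcut φ n⟩ - φ with hψ
    have hψp : ∀ p, ψ.1 p = φ.1 p * cutoff n p - φ.1 p := fun p => rfl
    have hz : ∀ p, ‖p‖ ≤ n → ψ.1 p = 0 := fun p hp => by
      rw [hψp, cutoff_eq_one hp]; ring
    have hb : ∀ p, |ψ.1 p| ≤ (|C| + 1) * weight p := fun p => by
      have e : ψ.1 p = - (φ.1 p * (1 - cutoff n p)) := by rw [hψp]; ring
      rw [e, abs_neg, abs_mul, abs_of_nonneg (sub_nonneg.2 (cutoff_le_one n p))]
      refine (mul_le_of_le_one_right (abs_nonneg _)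
        (sub_le_self _ (cutoff_nonneg n p))).trans ((hC p).trans ?_)
      exact mul_le_mul_of_nonneg_right ((le_abs_self C).trans (by linarith)) (hw0 p)
    have hsc : ∀ s : ℝ, |s| = (|C| + 1)⁻¹ → s * L ψ ≤ ε n := fun s hs => by
      have := htail n (s • ψ) hn (fun p hp => by
        change s * ψ.1 p = 0
        rw [hz p hp, mul_zero]) (fun p => by
        change |s * ψ.1 p| ≤ weight p
        rw [abs_mul, hs, inv_mul_le_iff₀ hC']
        exact hb p)
      rwa [map_smul, smul_eq_mul] at this
    have h1 := hsc (|C| + 1)⁻¹ (abs_of_pos (inv_pos.2 hC'))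
    have h2 := hsc (-(|C| + 1)⁻¹) (by rw [abs_neg, abs_of_pos (inv_pos.2 hC')])
    rw [inv_mul_le_iff₀ hC'] at h1
    rw [neg_mul, ← mul_neg, inv_mul_le_iff₀ hC'] at h2
    exact abs_le.2 ⟨by linarith, h1⟩
  have hz : Filter.Tendsto (fun n => (|C| + 1) * ε n) Filter.atTop (nhds 0) := by
    simpa using hε.const_mul (|C| + 1)
  exact squeeze_zero' (Filter.Eventually.of_forall fun n => dist_nonneg)
    (Filter.eventually_atTop.2 ⟨1, hdist⟩) hz

/-- The martingale identity `E[Y | Z] = Z`, tested on the events of `σ(Z)`. -/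
theorem condExp_sigmaOf_eq_iff {Ω : Type*} [MeasurableSpace Ω] {P : Measure Ω} [IsFiniteMeasure P]
    {Y Z : Ω → Rd d} (hZ : Measurable Z) (hYi : Integrable Y P) (hZi : Integrable Z P) :
    P[Y | sigmaOf Z] =ᵐ[P] Z ↔
      ∀ B, MeasurableSet B → ∫ ω in Z ⁻¹' B, Y ω ∂P = ∫ ω in Z ⁻¹' B, Z ω ∂P := by
  have hm : sigmaOf Z ≤ (inferInstance : MeasurableSpace Ω) := hZ.comap_le
  constructor
  · intro h B hB
    rw [← setIntegral_condExp hm hYi ⟨B, hB, rfl⟩]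
    exact integral_congr_ae (ae_restrict_of_ae h)
  · intro h
    refine (ae_eq_condExp_of_forall_setIntegral_eq hm hYi (fun s _ _ => hZi.integrableOn) ?_ ?_).symm
    · rintro s ⟨B, hB, rfl⟩ -
      exact (h B hB).symm
    · exact (comap_measurable Z).aestronglyMeasurable

/-- Orthogonality to the bounded continuous functions of `Z` implies orthogonality to all events
of `σ(Z)`. -/
theorem setIntegral_preimage_eq_zero {Ω : Type*} [MeasurableSpace Ω] {P : Measure Ω}
    [IsFiniteMeasure P] {u : Ω → ℝ} {Z : Ω → Rd d} (hZ : Measurable Z) (hu : Integrable u P)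
    (h : ∀ b : BoundedContinuousFunction (Rd d) ℝ, ∫ ω, b (Z ω) * u ω ∂P = 0)
    {B : Set (Rd d)} (hB : MeasurableSet B) : ∫ ω in Z ⁻¹' B, u ω ∂P = 0 := by
  have hfin : ∀ v : Ω → ℝ, Integrable v P →
      IsFiniteMeasure (P.withDensity fun ω => ENNReal.ofReal (v ω)) := fun v hv =>
    isFiniteMeasure_withDensity_ofReal hv.2
  have := hfin u hu
  have := hfin (fun ω => - u ω) hu.neg
  have hint : ∀ v : Ω → ℝ, Integrable v P → ∀ b : BoundedContinuousFunction (Rd d) ℝ,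
      ∫ x, b x ∂(P.withDensity fun ω => ENNReal.ofReal (v ω)).map Z =
        ∫ ω, b (Z ω) * max (v ω) 0 ∂P := fun v hv b => by
    rw [integral_map hZ.aemeasurable b.continuous.aestronglyMeasurable,
      integral_withDensity_eq_integral_toReal_smul₀ hv.aemeasurable.ennreal_ofReal
        (Filter.Eventually.of_forall fun _ => ENNReal.ofReal_lt_top)]
    refine integral_congr_ae (Filter.Eventually.of_forall fun ω => ?_)
    simp only [ENNReal.toReal_ofReal', smul_eq_mul, mul_comm]
  have hbi : ∀ v : Ω → ℝ, Integrable v P → ∀ b : BoundedContinuousFunction (Rd d) ℝ,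
      Integrable (fun ω => b (Z ω) * max (v ω) 0) P := fun v hv b =>
    hv.pos_part.bdd_mul (c := ‖b‖) (b.continuous.measurable.comp hZ).aestronglyMeasurable
      (Filter.Eventually.of_forall fun ω => b.norm_coe_le_norm _)
  have heq : (P.withDensity fun ω => ENNReal.ofReal (u ω)).map Z =
      (P.withDensity fun ω => ENNReal.ofReal (- u ω)).map Z := by
    refine ext_of_forall_integral_eq_of_IsFiniteMeasure fun b => ?_
    rw [hint u hu, hint (fun ω => - u ω) hu.neg, ← sub_eq_zero,
      ← integral_sub (hbi u hu b) (hbi (fun ω => - u ω) hu.neg b), ← h b]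
    refine integral_congr_ae (Filter.Eventually.of_forall fun ω => ?_)
    simp only [← mul_sub]
    rw [h b]
    rcases le_total 0 (u ω) with h0 | h0
    · rw [max_eq_left h0, max_eq_right (by linarith)]; ring
    · rw [max_eq_right h0, max_eq_left (by linarith)]; ring
  have hB' := congrArg (fun μ : Measure (Rd d) => (μ B).toReal) heq
  simp only [Measure.map_apply hZ hB, withDensity_apply _ (hZ hB)] at hB'
  rw [integral_eq_lintegral_pos_part_sub_lintegral_neg_part hu.integrableOn, hB', sub_self]

/-- The values of the dual problem with cost `φ`: integrals of functions `g` of `y` that dominate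
`φ` up to a term `⟨h(x), y - x⟩`, which backward martingale plans do not charge. -/
def dualValues (ν : Measure (Rd d)) (φ : Rd d × Rd d → ℝ) : Set ℝ :=
  {r | ∃ g : Rd d → ℝ, ∃ h : Rd d → Rd d, Integrable g ν ∧
    (∀ x y, φ (x, y) ≤ g y + inner ℝ (h x) (y - x)) ∧ r = ∫ y, g y ∂ν}

variable {ν : Measure (Rd d)}

theorem dualValues_nonempty [IsProbabilityMeasure ν]
    (hν : Integrable (fun y => ‖y‖ ^ 2) ν) {φ : Rd d × Rd d → ℝ}
    (hφ : φ ∈ quadGrowth d) : (dualValues ν φ).Nonempty := by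
  obtain ⟨C, hC⟩ := hφ
  refine ⟨_, fun y => |C| * (1 + 2 * ‖y‖ ^ 2), fun x => (-(2 * |C|)) • x,
    ((integrable_const 1).add (hν.const_mul 2)).const_mul _, fun x y => ?_, rfl⟩
  have h1 := (le_abs_self _).trans (hC (x, y))
  have h2 : C * weight (x, y) ≤ |C| * weight (x, y) :=
    mul_le_mul_of_nonneg_right (le_abs_self C) (zero_le_one.trans (one_le_weight _))
  have h3 : ‖x‖ ^ 2 ≤ ‖y‖ ^ 2 - 2 * inner ℝ x (y - x) := by
    have := norm_add_sq_real x (y - x)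
    rw [add_sub_cancel] at this
    nlinarith [sq_nonneg ‖y - x‖, norm_sub_sq_real y x, real_inner_comm x y,
      inner_sub_right (𝕜 := ℝ) x y x, real_inner_self_eq_norm_sq x]
  rw [inner_smul_left]
  simp only [weight, conj_trivial] at h2 h1 ⊢
  have h4 := mul_le_mul_of_nonneg_left h3 (abs_nonneg C)
  linarith

theorem le_of_mem_dualValues [IsProbabilityMeasure ν]
    (hν : Integrable (fun y => ‖y‖ ^ 2) ν) {φ : Rd d × Rd d → ℝ} {C : ℝ}
    (hφ : ∀ y, -(C * weight (y, y)) ≤ φ (y, y)) {r : ℝ} (hr : r ∈ dualValues ν φ) :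
    -(C * (1 + 2 * ∫ y, ‖y‖ ^ 2 ∂ν)) ≤ r := by
  obtain ⟨g, h, hg, hle, rfl⟩ := hr
  have h1 : ∫ y, -(C * (1 + 2 * ‖y‖ ^ 2)) ∂ν ≤ ∫ y, g y ∂ν := by
    refine integral_mono (((integrable_const 1).add (hν.const_mul 2)).const_mul _).neg hg
      fun y => ?_
    have h1 := hle y y
    have h2 := hφ y
    simp only [sub_self, inner_zero_right, add_zero, weight] at h1 h2
    linarith
  rwa [integral_neg, integral_const_mul, integral_add (integrable_const 1) (hν.const_mul 2),
    integral_const_mul, integral_const, probReal_univ, one_smul] at h1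

theorem bddBelow_dualValues [IsProbabilityMeasure ν]
    (hν : Integrable (fun y => ‖y‖ ^ 2) ν) {φ : Rd d × Rd d → ℝ}
    (hφ : φ ∈ quadGrowth d) : BddBelow (dualValues ν φ) := by
  obtain ⟨C, hC⟩ := hφ
  exact ⟨_, fun r hr => le_of_mem_dualValues hν (fun y => (abs_le.1 (hC (y, y))).1) hr⟩

theorem sInf_dualValues_smul_le [IsProbabilityMeasure ν]
    (hν : Integrable (fun y => ‖y‖ ^ 2) ν) {c : ℝ} (hc : 0 < c)
    (φ : quadGrowth d) : sInf (dualValues ν (c • φ).1) ≤ c * sInf (dualValues ν φ.1) := by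
  rw [← div_le_iff₀' hc]
  refine le_csInf (dualValues_nonempty hν φ.2) ?_
  rintro _ ⟨g, h, hg, hle, rfl⟩
  rw [div_le_iff₀' hc]
  refine csInf_le (bddBelow_dualValues hν (c • φ).2)
    ⟨fun y => c * g y, fun x => c • h x, hg.const_mul c, fun x y => ?_, ?_⟩
  · change c * φ.1 (x, y) ≤ _
    rw [inner_smul_left, conj_trivial, ← mul_add]
    exact mul_le_mul_of_nonneg_left (hle x y) hc.le
  · rw [integral_const_mul]

theorem sInf_dualValues_smul [IsProbabilityMeasure ν]
    (hν : Integrable (fun y => ‖y‖ ^ 2) ν) {c : ℝ} (hc : 0 < c)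
    (φ : quadGrowth d) : sInf (dualValues ν (c • φ).1) = c * sInf (dualValues ν φ.1) := by
  refine le_antisymm (sInf_dualValues_smul_le hν hc φ) ?_
  have := sInf_dualValues_smul_le hν (inv_pos.2 hc) (c • φ)
  rw [smul_smul, inv_mul_cancel₀ hc.ne', one_smul] at this
  exact (le_inv_mul_iff₀ hc).1 this

theorem sInf_dualValues_add_le [IsProbabilityMeasure ν]
    (hν : Integrable (fun y => ‖y‖ ^ 2) ν) (φ ψ : quadGrowth d) :
    sInf (dualValues ν (φ + ψ).1) ≤ sInf (dualValues ν φ.1) + sInf (dualValues ν ψ.1) := by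
  refine le_of_forall_pos_le_add fun ε hε => ?_
  obtain ⟨_, ⟨g₁, h₁, hg₁, hle₁, rfl⟩, hr₁⟩ :=
    Real.lt_sInf_add_pos (dualValues_nonempty hν φ.2) (half_pos hε)
  obtain ⟨_, ⟨g₂, h₂, hg₂, hle₂, rfl⟩, hr₂⟩ :=
    Real.lt_sInf_add_pos (dualValues_nonempty hν ψ.2) (half_pos hε)
  have : sInf (dualValues ν (φ + ψ).1) ≤ ∫ y, g₁ y ∂ν + ∫ y, g₂ y ∂ν := by
    refine csInf_le (bddBelow_dualValues hν (φ + ψ).2)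
      ⟨fun y => g₁ y + g₂ y, fun x => h₁ x + h₂ x, hg₁.add hg₂, fun x y => ?_,
        (integral_add hg₁ hg₂).symm⟩
    change φ.1 (x, y) + ψ.1 (x, y) ≤ _
    rw [inner_add_left]
    linarith [hle₁ x y, hle₂ x y]
  linarith

/-- Hahn-Banach: a linear functional dominated by all dual values which attains the optimal dual
value for a given cost. -/
theorem exists_functional_le_dualValues [IsProbabilityMeasure ν]
    (hν : Integrable (fun y => ‖y‖ ^ 2) ν)
    (φ₀ : quadGrowth d) : ∃ L : quadGrowth d →ₗ[ℝ] ℝ,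
      (∀ φ : quadGrowth d, ∀ r ∈ dualValues ν φ.1, L φ ≤ r) ∧
      ∀ ε > 0, ∃ r ∈ dualValues ν φ₀.1, r < L φ₀ + ε := by
  obtain ⟨N, hN⟩ : ∃ N : quadGrowth d → ℝ, ∀ φ, N φ = sInf (dualValues ν φ.1) :=
    ⟨_, fun _ => rfl⟩
  have h1 : ∀ c : ℝ, 0 < c → ∀ φ, N (c • φ) = c * N φ := fun c hc φ => by
    rw [hN, hN, sInf_dualValues_smul hν hc φ]
  have h2 : ∀ φ ψ, N (φ + ψ) ≤ N φ + N ψ := fun φ ψ => by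
    rw [hN, hN, hN]; exact sInf_dualValues_add_le hν φ ψ
  obtain ⟨L, hL₀, hL⟩ := exists_linearMap_eq_le_sublinear N h1 h2 φ₀
  refine ⟨L, fun φ r hr => ?_, fun ε hε => ?_⟩
  · exact (hL φ).trans ((hN φ).le.trans (csInf_le (bddBelow_dualValues hν φ.2) hr))
  · rw [hL₀, hN]
    exact Real.lt_sInf_add_pos (dualValues_nonempty hν φ₀.2) hε

/-- A functional dominated by the dual values vanishes on the functions `⟨h(x), y - x⟩` and
integrates functions of `y` with respect to `ν`. -/
theorem eq_integral_of_le_dualValues {L : quadGrowth d →ₗ[ℝ] ℝ}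
    (hL : ∀ φ : quadGrowth d, ∀ r ∈ dualValues ν φ.1, L φ ≤ r) (φ : quadGrowth d) {g : Rd d → ℝ}
    (hg : Integrable g ν) (h : Rd d → Rd d)
    (hφ : ∀ x y, φ.1 (x, y) = g y + inner ℝ (h x) (y - x)) : L φ = ∫ y, g y ∂ν := by
  refine le_antisymm (hL φ _ ⟨g, h, hg, fun x y => (hφ x y).le, rfl⟩) ?_
  have := hL (-φ) _ ⟨fun y => - g y, fun x => - h x, hg.neg, fun x y => ?_, rfl⟩
  · rw [map_neg, integral_neg] at this
    linarith
  · change - φ.1 (x, y) ≤ _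
    rw [hφ, inner_neg_left]
    linarith

/-- The convex function `(‖x‖² - n² / 2)⁺`, which controls the tail of `‖x‖²`. -/
noncomputable def tailFun (n : ℕ) (x : Rd d) : ℝ := max 0 (‖x‖ ^ 2 - n ^ 2 / 2)

theorem tailFun_nonneg (n : ℕ) (x : Rd d) : 0 ≤ tailFun n x := le_max_left _ _

theorem tailFun_le (n : ℕ) (x : Rd d) : tailFun n x ≤ ‖x‖ ^ 2 :=
  max_le (sq_nonneg _) (sub_le_self _ (by positivity))

theorem continuous_tailFun (n : ℕ) : Continuous (tailFun (d := d) n) := by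
  unfold tailFun; fun_prop

theorem exists_subgradient_tailFun (n : ℕ) (x : Rd d) :
    ∃ v : Rd d, ∀ y, tailFun n x + inner ℝ v (y - x) ≤ tailFun n y := by
  rcases le_total (‖x‖ ^ 2 - (n : ℝ) ^ 2 / 2) 0 with h | h
  · refine ⟨0, fun y => ?_⟩
    rw [inner_zero_left, add_zero, tailFun, max_eq_left h]
    exact tailFun_nonneg n y
  · refine ⟨(2 : ℝ) • x, fun y => ?_⟩
    refine le_trans ?_ (le_max_right _ _)
    rw [tailFun, max_eq_right h, inner_smul_left, conj_trivial]
    have := norm_add_sq_real x (y - x)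
    rw [add_sub_cancel] at this
    nlinarith [sq_nonneg ‖y - x‖]

theorem integrable_tailFun (hν : Integrable (fun y => ‖y‖ ^ 2) ν) (n : ℕ) :
    Integrable (tailFun n) ν :=
  hν.mono' (continuous_tailFun n).aestronglyMeasurable (Filter.Eventually.of_forall fun y => by
    rw [Real.norm_eq_abs, abs_of_nonneg (tailFun_nonneg n y)]; exact tailFun_le n y)

theorem tendsto_integral_tailFun (hν : Integrable (fun y => ‖y‖ ^ 2) ν) :
    Filter.Tendsto (fun n : ℕ => ∫ y, tailFun n y ∂ν) Filter.atTop (nhds 0) := by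
  rw [← integral_zero (Rd d) ℝ (μ := ν)]
  refine tendsto_integral_of_dominated_convergence _
    (fun n => (continuous_tailFun n).aestronglyMeasurable) hν
    (fun n => Filter.Eventually.of_forall fun y => ?_) (Filter.Eventually.of_forall fun y => ?_)
  · rw [Real.norm_eq_abs, abs_of_nonneg (tailFun_nonneg n y)]; exact tailFun_le n y
  · refine tendsto_const_nhds.congr' ?_
    filter_upwards [Filter.eventually_ge_atTop ⌈2 * ‖y‖⌉₊] with n hn
    have h1 : 2 * ‖y‖ ≤ n := Nat.ceil_le.1 hn
    refine (max_eq_left ?_).symm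
    nlinarith [norm_nonneg y]

theorem weight_le_tailFun {n : ℕ} (hn : 1 ≤ n) {p : Rd d × Rd d} (hp : n ≤ ‖p‖) :
    weight p ≤ 6 * (tailFun n p.1 + tailFun n p.2) := by
  have hn' : (1 : ℝ) ≤ n := by exact_mod_cast hn
  have key : ∀ u v : Rd d, ‖v‖ ≤ ‖u‖ → n ≤ ‖u‖ →
      1 + ‖u‖ ^ 2 + ‖v‖ ^ 2 ≤ 6 * (tailFun n u + tailFun n v) := fun u v hvu hu => by
    have h1 : ‖u‖ ^ 2 - (n : ℝ) ^ 2 / 2 ≤ tailFun n u := le_max_right _ _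
    have h2 := tailFun_nonneg n v
    nlinarith [norm_nonneg v]
  rw [Prod.norm_def] at hp
  unfold weight
  rcases le_total ‖p.1‖ ‖p.2‖ with h | h
  · rw [max_eq_right h] at hp
    linarith [key p.2 p.1 h hp]
  · rw [max_eq_left h] at hp
    exact key p.1 p.2 h hp

theorem integrable_sq_norm_of_memLp {Ω : Type*} [MeasurableSpace Ω] {P : Measure Ω} {Y : Ω → Rd d}
    (hY : MemLp Y 2 P) : Integrable (fun ω => ‖Y ω‖ ^ 2) P :=
  (memLp_two_iff_integrable_sq_norm hY.1).1 hY

theorem integrable_quad {Ω : Type*} [MeasurableSpace Ω] {P : Measure Ω}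
    {S : Matrix (Fin d) (Fin d) ℝ} {Y : Ω → Rd d} (hY : MemLp Y 2 P) :
    Integrable (fun ω => quad S (Y ω)) P := by
  obtain ⟨C, -, hC⟩ := exists_abs_sForm_le S
  refine ((integrable_sq_norm_of_memLp hY).const_mul C).mono'
    ((continuous_quad S).comp_aestronglyMeasurable hY.1) (Filter.Eventually.of_forall fun ω => ?_)
  have h1 := hC (Y ω) (Y ω)
  rw [Real.norm_eq_abs, quad, abs_mul, abs_of_pos (by norm_num : (0 : ℝ) < 1 / 2), sq]
  linarith [abs_nonneg (sForm S (Y ω) (Y ω))]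

/-- The envelope of the affine functions given by a dual feasible pair for the cost `S(x, x) / 2`
is a convex majorant of the quadratic form. -/
theorem exists_convex_majorant_of_dual {S : Matrix (Fin d) (Fin d) ℝ} {g : Rd d → ℝ}
    {h : Rd d → Rd d} (hle : ∀ x y, quad S x ≤ g y + inner ℝ (h x) (y - x)) :
    ∃ f : Rd d → ℝ, ConvexOn ℝ univ f ∧ (∀ x, quad S x ≤ f x) ∧ ∀ x, f x ≤ g x := by
  have hbdd : ∀ y, BddAbove (range fun x => quad S x - inner ℝ (h x) (y - x)) := fun y =>
    ⟨g y, by rintro _ ⟨x, rfl⟩; linarith [hle x y]⟩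
  refine ⟨fun y => ⨆ x, (quad S x - inner ℝ (h x) (y - x)), ⟨convex_univ, ?_⟩, fun y => ?_,
    fun y => ciSup_le fun x => by linarith [hle x y]⟩
  · intro y _ z _ α β hα hβ hαβ
    refine ciSup_le fun x => ?_
    have e1 := mul_le_mul_of_nonneg_left (le_ciSup (hbdd y) x) hα
    have e2 := mul_le_mul_of_nonneg_left (le_ciSup (hbdd z) x) hβ
    have e3 : α • y + β • z - x = α • (y - x) + β • (z - x) := by
      have : x = (α + β) • x := by rw [hαβ, one_smul]
      conv_lhs => rw [this]
      module
    rw [e3, inner_add_right, inner_smul_right, inner_smul_right]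
    have e4 : quad S x = α * quad S x + β * quad S x := by rw [← add_mul, hαβ, one_mul]
    simp only [smul_eq_mul]
    linarith
  · refine le_trans ?_ (le_ciSup (hbdd y) y)
    simp

/-- Duality without gap and existence of an optimal plan: some backward martingale plan has a value
that convex majorants of the quadratic form approximate from above. -/
theorem exists_plan_forall_exists_convex_majorant [IsProbabilityMeasure ν]
    (S : Matrix (Fin d) (Fin d) ℝ)
    (hν : MemLp (fun y : Rd d => y) 2 ν) :
    ∃ γ ∈ planSet ν, ∀ ε > 0, ∃ f : Rd d → ℝ, ConvexOn ℝ univ f ∧ (∀ x, quad S x ≤ f x) ∧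
      Integrable f ν ∧ ∫ y, f y ∂ν ≤ ∫ p, quad S p.1 ∂γ + ε := by
  have hsq := integrable_sq_norm_of_memLp hν
  have hqg : (fun p : Rd d × Rd d => quad S p.1) ∈ quadGrowth d := by
    obtain ⟨C, hC0, hC⟩ := exists_abs_sForm_le S
    refine mem_quadGrowth C fun p => ?_
    have h1 := hC p.1 p.1
    rw [quad, abs_mul, abs_of_pos (by norm_num : (0 : ℝ) < 1 / 2), weight]
    nlinarith [abs_nonneg (sForm S p.1 p.1), mul_nonneg hC0 (sq_nonneg ‖p.2‖)]
  obtain ⟨L, hL, hL₀⟩ := exists_functional_le_dualValues hsq ⟨_, hqg⟩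
  have hpos : ∀ φ : quadGrowth d, (∀ p, 0 ≤ φ.1 p) → 0 ≤ L φ := fun φ hφ => by
    have := hL (-φ) 0 ⟨0, 0, integrable_zero _ _ _, fun x y => ?_, by simp⟩
    · rw [map_neg] at this
      linarith
    · change - φ.1 (x, y) ≤ _
      have := hφ (x, y)
      simp only [Pi.zero_apply, inner_zero_left, add_zero]
      linarith
  choose v hv using fun n : ℕ => fun x : Rd d => exists_subgradient_tailFun n x
  obtain ⟨γ, hγ⟩ := exists_measure_of_tail L hpos (fun n => 12 * ∫ y, tailFun n y ∂ν)
    (by simpa using (tendsto_integral_tailFun hsq).const_mul 12) fun n φ hn hφ0 hφ => by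
      refine hL φ _ ⟨fun y => 12 * tailFun n y, fun x => (-6 : ℝ) • v n x,
        (integrable_tailFun hsq n).const_mul 12, fun x y => ?_, (integral_const_mul _ _).symm⟩
      have h1 : φ.1 (x, y) ≤ 6 * (tailFun n x + tailFun n y) := by
        rcases le_total ‖(x, y)‖ n with h | h
        · rw [hφ0 _ h]
          have := tailFun_nonneg n x
          have := tailFun_nonneg n y
          positivity
        · exact (le_abs_self _).trans ((hφ _).trans (weight_le_tailFun hn h))
      rw [inner_smul_left, conj_trivial]
      linarith [hv n x y]
  have hLeq := fun φ g hg h hφ => eq_integral_of_le_dualValues hL φ (g := g) hg h hφ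
  have hb1 : (fun _ : Rd d × Rd d => (1 : ℝ)) ∈ quadGrowth d :=
    mem_quadGrowth_of_bounded (C := 1) fun p => by simp
  obtain ⟨hi1, h1⟩ := hγ ⟨_, hb1⟩ continuous_const
  rw [hLeq _ (fun _ => 1) (integrable_const _) 0 (fun x y => by simp)] at h1
  have hfin : IsFiniteMeasure γ := by
    rcases integrable_const_iff.1 hi1 with h | h
    · exact absurd h one_ne_zero
    · exact h
  have hprob : IsProbabilityMeasure γ := ⟨by
    simp only [integral_const, smul_eq_mul, mul_one, probReal_univ] at h1
    rw [← ENNReal.toReal_eq_one_iff]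
    exact h1⟩
  have hw : ∀ p : Rd d × Rd d, ‖p.1‖ ^ 2 ≤ weight p ∧ ‖p.2‖ ^ 2 ≤ weight p := fun p => by
    unfold weight
    constructor <;> nlinarith [sq_nonneg ‖p.1‖, sq_nonneg ‖p.2‖]
  have hm1 : MemLp (fun p : Rd d × Rd d => p.1) 2 γ := by
    rw [memLp_two_iff_integrable_sq_norm continuous_fst.aestronglyMeasurable]
    exact (hγ ⟨fun p => ‖p.1‖ ^ 2, mem_quadGrowth 1 fun p => by
      rw [one_mul, abs_of_nonneg (sq_nonneg _)]; exact (hw p).1⟩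
      (continuous_fst.norm.pow 2)).1
  have hm2 : MemLp (fun p : Rd d × Rd d => p.2) 2 γ := by
    rw [memLp_two_iff_integrable_sq_norm continuous_snd.aestronglyMeasurable]
    exact (hγ ⟨fun p => ‖p.2‖ ^ 2, mem_quadGrowth 1 fun p => by
      rw [one_mul, abs_of_nonneg (sq_nonneg _)]; exact (hw p).2⟩
      (continuous_snd.norm.pow 2)).1
  have hmarg : γ.map Prod.snd = ν := by
    have : IsProbabilityMeasure (γ.map Prod.snd) :=
      Measure.isProbabilityMeasure_map measurable_snd.aemeasurable
    refine ext_of_forall_integral_eq_of_IsFiniteMeasure fun b => ?_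
    have hb : (fun p : Rd d × Rd d => b p.2) ∈ quadGrowth d :=
      mem_quadGrowth_of_bounded fun p => b.norm_coe_le_norm p.2
    rw [integral_map measurable_snd.aemeasurable b.continuous.aestronglyMeasurable,
      (hγ ⟨_, hb⟩ (b.continuous.comp continuous_snd)).2]
    exact hLeq _ _ (b.integrable ν) 0 fun x y => by simp
  have hi1 := hm1.integrable one_le_two
  have hi2 := hm2.integrable one_le_two
  have hcond : γ[(fun p : Rd d × Rd d => p.2) | sigmaOf (fun p : Rd d × Rd d => p.1)]
      =ᵐ[γ] fun p => p.1 := by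
    rw [condExp_sigmaOf_eq_iff measurable_fst hi2 hi1]
    intro B hB
    rw [← sub_eq_zero, ← integral_sub hi2.integrableOn hi1.integrableOn]
    ext i
    have hcomm := (EuclideanSpace.proj (𝕜 := ℝ) i : Rd d →L[ℝ] ℝ).integral_comp_comm
      (hi2.sub hi1).integrableOn (μ := γ.restrict ((fun p : Rd d × Rd d => p.1) ⁻¹' B))
    have hz := setIntegral_preimage_eq_zero (u := fun p : Rd d × Rd d => p.2 i - p.1 i)
      measurable_fst ((EuclideanSpace.proj (𝕜 := ℝ) i : Rd d →L[ℝ] ℝ).integrable_comp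
        (hi2.sub hi1)) (fun b => ?_) hB
    · exact hcomm.symm.trans hz
    · have hb : (fun p : Rd d × Rd d => b p.1 * (p.2 i - p.1 i)) ∈ quadGrowth d := by
        refine mem_quadGrowth ‖b‖ fun p => ?_
        rw [abs_mul]
        refine mul_le_mul (b.norm_coe_le_norm p.1) ?_ (abs_nonneg _) (norm_nonneg _)
        have e1 : |p.2 i| ≤ ‖p.2‖ := PiLp.norm_apply_le p.2 i
        have e2 : |p.1 i| ≤ ‖p.1‖ := PiLp.norm_apply_le p.1 i
        refine (abs_sub _ _).trans ?_
        unfold weight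
        nlinarith [sq_nonneg (‖p.1‖ - 1), sq_nonneg (‖p.2‖ - 1)]
      have hbc : Continuous fun p : Rd d × Rd d => b p.1 * (p.2 i - p.1 i) := by fun_prop
      rw [(hγ ⟨_, hb⟩ hbc).2, hLeq _ (fun _ => 0) (integrable_zero _ _ _)
        (fun x => b x • EuclideanSpace.single i 1) (fun x y => by
          simp [inner_smul_left, EuclideanSpace.inner_single_left])]
      simp
  refine ⟨γ, ⟨hprob, hm1, hm2, hmarg, hcond⟩, fun ε hε => ?_⟩
  obtain ⟨_, ⟨g, h, hg, hle, rfl⟩, hr⟩ := hL₀ ε hε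
  obtain ⟨f, hf, hqf, hfg⟩ := exists_convex_majorant_of_dual hle
  have hfi : Integrable f ν := by
    refine ((integrable_quad (S := S) hν).norm.add hg.norm).mono'
      (continuousOn_univ.1 (hf.continuousOn isOpen_univ)).aestronglyMeasurable
      (Filter.Eventually.of_forall fun y => ?_)
    have h1 := hqf y
    have h2 := hfg y
    simp only [Pi.add_apply, Real.norm_eq_abs]
    exact abs_le.2 ⟨by linarith [neg_abs_le (quad S y), abs_nonneg (g y)],
      by linarith [le_abs_self (g y), abs_nonneg (quad S y)]⟩
  refine ⟨f, hf, hqf, hfi, ?_⟩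
  rw [(hγ ⟨_, hqg⟩ ((continuous_quad S).comp continuous_fst)).2]
  exact (integral_mono hfi hg hfg).trans hr.le

end Duality

/-! ### Geometry of the projection multifunction -/

section Projection

variable {d : ℕ} {S : Matrix (Fin d) (Fin d) ℝ} {G : Set (Rd d)}

theorem quad_sub_nonneg (hG : SMonotone S G) {x y : Rd d} (hx : x ∈ G) (hy : y ∈ G) :
    0 ≤ quad S (x - y) := by
  have := hG x hx y hy
  rw [sForm_self] at this
  linarith

theorem mem_of_forall_quad_sub_nonneg (hG : G ∈ MaxSMonotone S) {x : Rd d}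
    (hx : ∀ z ∈ G, 0 ≤ quad S (x - z)) : x ∈ G := by
  have h : SMonotone S (insert x G) := by
    have h0 : ∀ z ∈ G, 0 ≤ sForm S (x - z) (x - z) := fun z hz => by
      rw [sForm_self]; linarith [hx z hz]
    rintro u (rfl | hu) v (rfl | hv)
    · rw [sForm_self, sub_self, quad_zero, mul_zero]
    · exact h0 v hv
    · have := h0 u hu
      rwa [sForm_self, ← quad_neg, neg_sub, ← sForm_self] at this
    · exact hG.1 u hu v hv
  exact hG.2 h (subset_insert x G) (mem_insert x G)

theorem mem_proj_iff (hS : S.IsSymm) {x y : Rd d} : x ∈ proj S G y ↔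
    x ∈ G ∧ ∀ z ∈ G, sForm S z y - quad S z ≤ sForm S x y - quad S x := by
  simp only [proj, mem_ofPred_eq, sForm_self, quad_sub hS]
  refine and_congr_right fun _ => forall₂_congr fun z _ => ?_
  constructor <;> intro h <;> linarith

/-- The projection of a point of `G` consists of the points of `G` at zero `S`-distance. -/
theorem mem_proj_iff_of_mem (hG : SMonotone S G) {x z : Rd d} (hz : z ∈ G) :
    x ∈ proj S G z ↔ x ∈ G ∧ quad S (x - z) = 0 := by
  simp only [proj, mem_ofPred_eq, sForm_self]
  refine and_congr_right fun hx => ⟨fun h => ?_, fun h u hu => ?_⟩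
  · have h1 := h z hz
    rw [sub_self, quad_zero] at h1
    linarith [quad_sub_nonneg hG hx hz]
  · linarith [quad_sub_nonneg hG hu hz]

theorem isClosed_proj (hG : G ∈ MaxSMonotone S) (y : Rd d) : IsClosed (proj S G y) :=
  (isClosed_graph_proj hG).preimage (f := fun x : Rd d => (x, y)) (by fun_prop)

/-- Away from `Σ₁(P_G)` the projection is isotropic. -/
theorem quad_sub_eq_zero_of_notMem_singularSetOne (hG : SMonotone S G) {y u v : Rd d}
    (hy : y ∉ singularSetOne S G) (hu : u ∈ proj S G y) (hv : v ∈ proj S G y) :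
    quad S (u - v) = 0 := by
  refine le_antisymm ?_ (quad_sub_nonneg hG hu.1 hv.1)
  by_contra! h
  refine hy ⟨⟨⟨u, hu⟩, ?_⟩, u, hu, v, hv, by rw [sForm_self]; linarith⟩
  rintro ⟨x, hx⟩
  rw [hx, mem_singleton_iff] at hu hv
  rw [hu, hv, sub_self, quad_zero] at h
  exact lt_irrefl _ h

theorem convex_proj (hS : S.IsSymm) (hG : G ∈ MaxSMonotone S) {y : Rd d}
    (hy : y ∉ singularSetOne S G) : Convex ℝ (proj S G y) := by
  intro u hu v hv α β hα hβ hαβ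
  have huv := quad_sub_eq_zero_of_notMem_singularSetOne hG.1 hy hu hv
  have hβ' : β = 1 - α := by linarith
  have hq : ∀ z, quad S (α • u + β • v - z) = α * quad S (u - z) + β * quad S (v - z) := by
    intro z
    have e : α • u + β • v - z = α • (u - z) + β • (v - z) := by
      rw [hβ']; module
    have e2 : u - v = (u - z) - (v - z) := by abel
    rw [e2, quad_sub hS] at huv
    rw [e, quad_add hS, quad_smul, quad_smul, sForm_smul_left, sForm_smul_right, hβ']
    linear_combination (-α * (1 - α)) * huv
  rw [mem_proj_iff hS] at hu hv ⊢
  refine ⟨mem_of_forall_quad_sub_nonneg hG fun z hz => ?_, fun z hz => ?_⟩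
  · rw [hq z]
    exact add_nonneg (mul_nonneg hα (quad_sub_nonneg hG.1 hu.1 hz))
      (mul_nonneg hβ (quad_sub_nonneg hG.1 hv.1 hz))
  · have h0 := hq y
    rw [quad_sub hS, quad_sub hS, quad_sub hS] at h0
    have h1 := mul_le_mul_of_nonneg_left (hu.2 z hz) hα
    have h2 := mul_le_mul_of_nonneg_left (hv.2 z hz) hβ
    have h3 : ∀ c : ℝ, α * c + β * c = c := fun c => by rw [← add_mul, hαβ, one_mul]
    linarith [h3 (sForm S z y - quad S z), h3 (quad S y)]

/-- If `z` lies in an isotropic projection `P_G(y)`, then `P_G(y) ⊆ P_G(z)`. -/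
theorem proj_subset_proj_of_mem (hG : SMonotone S G) {y z : Rd d} (hy : y ∉ singularSetOne S G)
    (hz : z ∈ proj S G y) : proj S G y ⊆ proj S G z := fun _ hu =>
  (mem_proj_iff_of_mem hG hz.1).2
    ⟨hu.1, quad_sub_eq_zero_of_notMem_singularSetOne hG hy hu hz⟩

/-- The events of `σ(P_G)` depend on a point through its projection only. -/
theorem mem_iff_of_proj_eq {B : Set (Rd d)} (hB : MeasurableSet[sigmaProj S G] B) {y z : Rd d}
    (h : proj S G y = proj S G z) : y ∈ B ↔ z ∈ B := by
  have hle : sigmaProj S G ≤ (⊤ : MeasurableSpace (Set (Rd d))).comap (proj S G) := by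
    refine MeasurableSpace.generateFrom_le ?_
    rintro A ⟨U, -, rfl⟩
    exact ⟨{F | (F ∩ U).Nonempty}, trivial, rfl⟩
  obtain ⟨C, -, rfl⟩ := hle B hB
  rw [mem_preimage, mem_preimage, h]

/-- The Fitzpatrick function dominates the quadratic form, and touches it on `G` only. -/
theorem quad_le_of_forall_le (hS : S.IsSymm) (hG : G ∈ MaxSMonotone S) {x : Rd d} {c : ℝ}
    (hc : ∀ z ∈ G, sForm S z x - quad S z ≤ c) : quad S x ≤ c ∧ (c = quad S x → x ∈ G) := by
  have hmem : c ≤ quad S x → x ∈ G := fun h =>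
    mem_of_forall_quad_sub_nonneg hG fun z hz => by
      rw [quad_sub hS, sForm_comm hS]
      linarith [hc z hz]
  refine ⟨?_, fun h => hmem h.le⟩
  by_contra! h
  have := hc x (hmem h.le)
  rw [sForm_self] at this
  linarith

theorem le_fitzpatrick {z : Rd d} (hz : z ∈ G) (y : Rd d) :
    ((sForm S z y - quad S z : ℝ) : EReal) ≤ fitzpatrick S G y :=
  le_iSup₂ (f := fun x (_ : x ∈ G) => ((sForm S x y - 1 / 2 * sForm S x x : ℝ) : EReal)) z hz

theorem quad_le_fitzpatrick (hS : S.IsSymm) (hG : G ∈ MaxSMonotone S) (y : Rd d) :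
    (quad S y : EReal) ≤ fitzpatrick S G y := by
  by_contra! h
  obtain ⟨c, hc1, hc2⟩ := EReal.lt_iff_exists_real_btwn.1 h
  have := (quad_le_of_forall_le hS hG (c := c) fun z hz =>
    EReal.coe_le_coe_iff.1 ((le_fitzpatrick hz y).trans hc1.le)).1
  exact (EReal.coe_lt_coe_iff.1 hc2).not_ge this

theorem measurable_fitzpatrick : Measurable (fitzpatrick S G) := by
  refine LowerSemicontinuous.measurable (lowerSemicontinuous_biSup fun x _ => ?_)
  refine Continuous.lowerSemicontinuous (continuous_coe_real_ereal.comp ?_)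
  exact (continuous_sForm S continuous_const continuous_id).sub continuous_const

end Projection

/-! ### The integral of the Fitzpatrick function -/

section DualSide

variable {d : ℕ} {S : Matrix (Fin d) (Fin d) ℝ} {G : Set (Rd d)} {ν : Measure (Rd d)}

theorem extIntegral_mono {α : Type*} [MeasurableSpace α] {μ : Measure α} {f g : α → EReal}
    (h : ∀ a, f a ≤ g a) : extIntegral μ f ≤ extIntegral μ g :=
  EReal.sub_le_sub
    (EReal.coe_ennreal_le_coe_ennreal_iff.2
      (lintegral_mono fun a => EReal.toENNReal_le_toENNReal (h a)))
    (EReal.coe_ennreal_le_coe_ennreal_iff.2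
      (lintegral_mono fun a => EReal.toENNReal_le_toENNReal (EReal.neg_le_neg_iff.2 (h a))))

theorem extIntegral_coe {α : Type*} [MeasurableSpace α] {μ : Measure α} {f : α → ℝ}
    (hf : Integrable f μ) : extIntegral μ (fun a => (f a : EReal)) = ((∫ a, f a ∂μ : ℝ) : EReal) := by
  have h1 : ∫⁻ a, ENNReal.ofReal (f a) ∂μ ≠ ⊤ := hf.lintegral_lt_top.ne
  have h2 : ∫⁻ a, ENNReal.ofReal (-f a) ∂μ ≠ ⊤ := hf.neg.lintegral_lt_top.ne
  rw [integral_eq_lintegral_pos_part_sub_lintegral_neg_part hf, EReal.coe_sub,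
    EReal.coe_ennreal_toReal h1, EReal.coe_ennreal_toReal h2]
  simp only [extIntegral, ← EReal.coe_neg, EReal.real_coe_toENNReal]

/-- The Fitzpatrick function of a dual optimal set is a.e. a finite integrable function `r`, whose
integral is minimal among the convex majorants of the quadratic form. -/
theorem exists_integrable_isLUB {m : ℕ} (hS : S ∈ SymIndex d m)
    (hν : MemLp (fun y : Rd d => y) 2 ν) (hG : IsDualOptimal S ν G)
    (hex : ∃ f : Rd d → ℝ, ConvexOn ℝ univ f ∧ (∀ x, quad S x ≤ f x) ∧ Integrable f ν) :
    ∃ r : Rd d → ℝ, Integrable r ν ∧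
      (∀ᵐ y ∂ν, IsLUB ((fun z => sForm S z y - quad S z) '' G) (r y)) ∧
      ∀ f : Rd d → ℝ, ConvexOn ℝ univ f → (∀ x, quad S x ≤ f x) → Integrable f ν →
        ∫ y, r y ∂ν ≤ ∫ y, f y ∂ν := by
  have hle : ∀ f : Rd d → ℝ, ConvexOn ℝ univ f → (∀ x, quad S x ≤ f x) → Integrable f ν →
      extIntegral ν (fitzpatrick S G) ≤ ((∫ y, f y ∂ν : ℝ) : EReal) := fun f hf hqf hfi => by
    obtain ⟨G', hG', hG'f⟩ := exists_maxSMonotone_fitzpatrick_le hS hf hqf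
    rw [← extIntegral_coe hfi]
    exact (hG.2 G' hG').trans (extIntegral_mono hG'f)
  have hq : ∀ y, (quad S y : EReal) ≤ fitzpatrick S G y := quad_le_fitzpatrick hS.1 hG.1
  have hqi := integrable_quad (S := S) hν
  have hneg : ∫⁻ y, (-(fitzpatrick S G y)).toENNReal ∂ν ≠ ⊤ := by
    refine ne_top_of_le_ne_top hqi.neg.lintegral_lt_top.ne (lintegral_mono fun y => ?_)
    rw [Pi.neg_apply, ← EReal.real_coe_toENNReal, EReal.coe_neg]
    exact EReal.toENNReal_le_toENNReal (EReal.neg_le_neg_iff.2 (hq y))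
  have hpos : ∫⁻ y, (fitzpatrick S G y).toENNReal ∂ν ≠ ⊤ := by
    obtain ⟨f, hf, hqf, hfi⟩ := hex
    intro htop
    have := hle f hf hqf hfi
    rw [extIntegral, htop, ← EReal.coe_ennreal_toReal hneg, EReal.coe_ennreal_top,
      EReal.top_sub_coe] at this
    exact EReal.coe_ne_top _ (top_le_iff.1 this)
  have hmeas := measurable_fitzpatrick (S := S) (G := G)
  have hfin : ∀ᵐ y ∂ν, fitzpatrick S G y = ((fitzpatrick S G y).toReal : EReal) := by
    filter_upwards [ae_lt_top hmeas.ereal_toENNReal hpos] with y hy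
    refine (EReal.coe_toReal (EReal.toENNReal_ne_top_iff.1 hy.ne) ?_).symm
    exact ((EReal.bot_lt_coe _).trans_le (hq y)).ne'
  have hr : Integrable (fun y => (fitzpatrick S G y).toReal) ν := by
    refine ⟨hmeas.ereal_toReal.aestronglyMeasurable, ?_⟩
    rw [hasFiniteIntegral_iff_norm]
    have : ∫⁻ y, ENNReal.ofReal ‖(fitzpatrick S G y).toReal‖ ∂ν ≤
        ∫⁻ y, (fitzpatrick S G y).toENNReal + (-(fitzpatrick S G y)).toENNReal ∂ν := by
      refine lintegral_mono_ae ?_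
      filter_upwards [hfin] with y hy
      rw [hy, ← EReal.coe_neg, EReal.real_coe_toENNReal, EReal.real_coe_toENNReal,
        EReal.toReal_coe, Real.norm_eq_abs]
      rcases le_total 0 (fitzpatrick S G y).toReal with h | h
      · rw [abs_of_nonneg h]; exact le_self_add
      · rw [abs_of_nonpos h]; exact le_add_self
    refine this.trans_lt ?_
    rw [lintegral_add_left hmeas.ereal_toENNReal]
    exact ENNReal.add_lt_top.2 ⟨hpos.lt_top, hneg.lt_top⟩
  refine ⟨fun y => (fitzpatrick S G y).toReal, hr, ?_, fun f hf hqf hfi => ?_⟩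
  · filter_upwards [hfin] with y hy
    refine ⟨?_, fun c hc => ?_⟩
    · rintro _ ⟨z, hz, rfl⟩
      have := le_fitzpatrick (S := S) hz y
      rw [hy] at this
      exact EReal.coe_le_coe_iff.1 this
    · rw [← EReal.coe_le_coe_iff, ← hy]
      exact iSup₂_le fun z hz => EReal.coe_le_coe_iff.2 (hc ⟨z, hz, rfl⟩)
  · have h1 : extIntegral ν (fitzpatrick S G) =
        extIntegral ν fun y => ((fitzpatrick S G y).toReal : EReal) := by
      unfold extIntegral
      congr 2
      · exact lintegral_congr_ae (hfin.mono fun y hy => by simp only [← hy])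
      · exact lintegral_congr_ae (hfin.mono fun y hy => by simp only [← hy])
    have h2 := hle f hf hqf hfi
    rw [h1, extIntegral_coe hr] at h2
    exact EReal.coe_le_coe_iff.1 h2

end DualSide

/-! ### Backward martingale pairs and weak duality -/

section Pairs

variable {d : ℕ} {S : Matrix (Fin d) (Fin d) ℝ} {G : Set (Rd d)}
  {Ω : Type*} [MeasurableSpace Ω] {P : Measure Ω} {Y Z : Ω → Rd d}

/-- A pair of square integrable random variables with `E[Y | Z] = Z`. -/
structure IsBackwardPair (P : Measure Ω) (Z Y : Ω → Rd d) : Prop where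
  measurable_left : Measurable Z
  measurable_right : Measurable Y
  memLp_left : MemLp Z 2 P
  memLp_right : MemLp Y 2 P
  condExp_eq : P[Y | sigmaOf Z] =ᵐ[P] Z

/-- The form as a continuous bilinear map. -/
theorem exists_bilin (S : Matrix (Fin d) (Fin d) ℝ) :
    ∃ B : Rd d →L[ℝ] Rd d →L[ℝ] ℝ, ∀ x y, B x y = sForm S x y := by
  obtain ⟨C, -, hC⟩ := exists_abs_sForm_le S
  refine ⟨(LinearMap.mk₂ ℝ (sForm S) (sForm_add_left S) (sForm_smul_left S) (sForm_add_right S)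
    (sForm_smul_right S)).mkContinuous₂ C fun x y => ?_, fun x y => rfl⟩
  rw [mul_assoc]
  exact hC x y

theorem integrable_sForm (hZ : MemLp Z 2 P) (hY : MemLp Y 2 P) :
    Integrable (fun ω => sForm S (Z ω) (Y ω)) P := by
  obtain ⟨B, hB⟩ := exists_bilin S
  obtain ⟨C, hC0, hC⟩ := exists_abs_sForm_le S
  refine ((integrable_sq_norm_of_memLp hZ).add (integrable_sq_norm_of_memLp hY)).const_mul C
    |>.mono' ?_ (Filter.Eventually.of_forall fun ω => (hC _ _).trans ?_)
  · simp only [← hB]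
    exact B.aestronglyMeasurable_comp₂ hZ.1 hY.1
  · refine mul_le_mul_of_nonneg_left ?_ hC0
    simp only [Pi.add_apply]
    nlinarith [sq_nonneg (‖Z ω‖ - ‖Y ω‖), sq_nonneg (‖Z ω‖), sq_nonneg (‖Y ω‖)]

variable [IsProbabilityMeasure P]

theorem IsBackwardPair.integral_sForm (h : IsBackwardPair P Z Y) :
    ∫ ω, sForm S (Z ω) (Y ω) ∂P = 2 * ∫ ω, quad S (Z ω) ∂P := by
  obtain ⟨B, hB⟩ := exists_bilin S
  have hm := h.measurable_left.comap_le
  have h1 := condExp_bilin_of_aestronglyMeasurable_left (m := sigmaOf Z) (μ := P) (g := Y) B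
    (comap_measurable Z).aestronglyMeasurable
    (by simpa only [hB] using integrable_sForm h.memLp_left h.memLp_right)
    (h.memLp_right.integrable one_le_two)
  simp only [hB] at h1
  rw [← integral_condExp hm, ← integral_const_mul]
  refine integral_congr_ae ?_
  filter_upwards [h1, h.condExp_eq] with ω h2 h3
  rw [h2, h3, sForm_self]

/-- Conditional expectation given `Z` of an affine function of `Y`. -/
theorem IsBackwardPair.condExp_affine (h : IsBackwardPair P Z Y) (z : Rd d) :
    P[fun ω => sForm S z (Y ω) - quad S z | sigmaOf Z] =ᵐ[P]
      fun ω => sForm S z (Z ω) - quad S z := by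
  obtain ⟨B, hB⟩ := exists_bilin S
  have hm := h.measurable_left.comap_le
  have hYi := h.memLp_right.integrable one_le_two
  have h1 := (B z).comp_condExp_comm (m := sigmaOf Z) hYi
  have h2 := condExp_sub (m := sigmaOf Z) ((B z).integrable_comp hYi)
    (integrable_const (μ := P) (quad S z))
  have e : (fun ω => sForm S z (Y ω) - quad S z) = (fun ω => B z (Y ω)) - fun _ => quad S z := by
    ext ω; simp [hB]
  rw [e]
  filter_upwards [h1, h2, h.condExp_eq] with ω h3 h4 h5
  have h3' : B z ((P[Y | sigmaOf Z]) ω) = (P[fun a => B z (Y a) | sigmaOf Z]) ω := h3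
  rw [h4, Pi.sub_apply, condExp_const hm, ← h3', h5, hB]

/-- Jensen's inequality `ψ_G(Z) ≤ E[ψ_G(Y) | Z]`, with `R` in the role of `ψ_G(Y)`. -/
theorem IsBackwardPair.ae_forall_le_condExp (h : IsBackwardPair P Z Y)
    {R : Ω → ℝ} (hR : Integrable R P)
    (hle : ∀ᵐ ω ∂P, ∀ z ∈ G, sForm S z (Y ω) - quad S z ≤ R ω) :
    ∀ᵐ ω ∂P, ∀ z ∈ G, sForm S z (Z ω) - quad S z ≤ (P[R | sigmaOf Z]) ω := by
  obtain ⟨D, hDG, hDc, hGD⟩ :=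
    (TopologicalSpace.IsSeparable.of_separableSpace G).exists_countable_dense_subset
  have hYi := h.memLp_right.integrable one_le_two
  obtain ⟨B, hB⟩ := exists_bilin S
  have hD : ∀ᵐ ω ∂P, ∀ z ∈ D, sForm S z (Z ω) - quad S z ≤ (P[R | sigmaOf Z]) ω := by
    rw [ae_ball_iff hDc]
    intro z hz
    have hi : Integrable (fun ω => sForm S z (Y ω) - quad S z) P := by
      simp only [← hB]
      exact ((B z).integrable_comp hYi).sub (integrable_const _)
    filter_upwards [h.condExp_affine z, condExp_mono (m := sigmaOf Z) hi hR
      (hle.mono fun ω hω => hω z (hDG hz))] with ω h1 h2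
    rwa [← h1]
  filter_upwards [hD] with ω hω z hz
  have hcl : IsClosed {z | sForm S z (Z ω) - quad S z ≤ (P[R | sigmaOf Z]) ω} :=
    isClosed_le ((continuous_sForm S continuous_id continuous_const).sub (continuous_quad S))
      continuous_const
  exact closure_minimal hω hcl (hGD hz)

/-- Weak duality: the quadratic form is dominated by `ψ_G`, so that Jensen's inequality bounds the
value of a backward martingale pair by `E[ψ_G(Y)]`. -/
theorem IsBackwardPair.integral_quad_le (h : IsBackwardPair P Z Y) (hS : S.IsSymm)
    (hG : G ∈ MaxSMonotone S) {R : Ω → ℝ} (hR : Integrable R P)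
    (hle : ∀ᵐ ω ∂P, ∀ z ∈ G, sForm S z (Y ω) - quad S z ≤ R ω) :
    ∫ ω, quad S (Z ω) ∂P ≤ ∫ ω, R ω ∂P := by
  rw [← integral_condExp h.measurable_left.comap_le (f := R)]
  refine integral_mono_ae (integrable_quad h.memLp_left) integrable_condExp ?_
  filter_upwards [h.ae_forall_le_condExp hR hle] with ω hω
  exact (quad_le_of_forall_le hS hG hω).1

/-- Complementary slackness: equality in weak duality forces `Z ∈ P_G(Y)`. -/
theorem IsBackwardPair.ae_mem_proj (h : IsBackwardPair P Z Y) (hS : S.IsSymm)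
    (hG : G ∈ MaxSMonotone S) {R : Ω → ℝ} (hR : Integrable R P)
    (hle : ∀ᵐ ω ∂P, ∀ z ∈ G, sForm S z (Y ω) - quad S z ≤ R ω)
    (heq : ∫ ω, R ω ∂P ≤ ∫ ω, quad S (Z ω) ∂P) : ∀ᵐ ω ∂P, Z ω ∈ proj S G (Y ω) := by
  have hm := h.measurable_left.comap_le
  have hbound := h.ae_forall_le_condExp hR hle
  have hqi := integrable_quad (S := S) h.memLp_left
  have heq' : ∫ ω, R ω ∂P = ∫ ω, quad S (Z ω) ∂P :=
    le_antisymm heq (h.integral_quad_le hS hG hR hle)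
  have h1 : (fun ω => quad S (Z ω)) =ᵐ[P] P[R | sigmaOf Z] := by
    refine (integral_eq_iff_of_ae_le hqi integrable_condExp ?_).1 ?_
    · filter_upwards [hbound] with ω hω
      exact (quad_le_of_forall_le hS hG hω).1
    · rw [integral_condExp hm, heq']
  have hZG : ∀ᵐ ω ∂P, Z ω ∈ G := by
    filter_upwards [hbound, h1] with ω hω h2
    exact (quad_le_of_forall_le hS hG hω).2 h2.symm
  have hsi := integrable_sForm (S := S) h.memLp_left h.memLp_right
  have h2 : (fun ω => sForm S (Z ω) (Y ω) - quad S (Z ω)) =ᵐ[P] R := by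
    refine (integral_eq_iff_of_ae_le (hsi.sub hqi) hR ?_).1 ?_
    · filter_upwards [hle, hZG] with ω hω hω'
      exact hω _ hω'
    · simp only [Pi.sub_apply]
      rw [integral_sub hsi hqi, h.integral_sForm, heq']
      ring
  filter_upwards [hle, hZG, h2] with ω h3 h4 h5
  exact (mem_proj_iff hS).2 ⟨h4, fun z hz => (h3 z hz).trans h5.ge⟩

/-- A backward martingale pair with `Z ∈ P_G(Y)` attains the dual bound. -/
theorem IsBackwardPair.integral_quad_eq (h : IsBackwardPair P Z Y) (hS : S.IsSymm)
    {R : Ω → ℝ}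
    (hlub : ∀ᵐ ω ∂P, IsLUB ((fun z => sForm S z (Y ω) - quad S z) '' G) (R ω))
    (hmem : ∀ᵐ ω ∂P, Z ω ∈ proj S G (Y ω)) : ∫ ω, quad S (Z ω) ∂P = ∫ ω, R ω ∂P := by
  have hqi := integrable_quad (S := S) h.memLp_left
  have hsi := integrable_sForm (S := S) h.memLp_left h.memLp_right
  have h1 : ∫ ω, R ω ∂P = ∫ ω, sForm S (Z ω) (Y ω) - quad S (Z ω) ∂P := by
    refine integral_congr_ae ?_
    filter_upwards [hlub, hmem] with ω h2 h3
    rw [mem_proj_iff hS] at h3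
    refine h2.unique (IsGreatest.isLUB ⟨⟨_, h3.1, rfl⟩, ?_⟩)
    rintro _ ⟨z, hz, rfl⟩
    exact h3.2 z hz
  rw [h1, integral_sub hsi hqi, h.integral_sForm]
  ring

theorem isBackwardPair_of_mem_planSet {ν : Measure (Rd d)} {γ : Measure (Rd d × Rd d)}
    (hγ : γ ∈ planSet ν) : IsBackwardPair γ Prod.fst Prod.snd :=
  ⟨measurable_fst, measurable_snd, hγ.2.1, hγ.2.2.1, hγ.2.2.2.2⟩

/-- The backward martingale property is a property of the joint law. -/
theorem jointLaw_mem_planSet_iff (hZ : Measurable Z) (hY : Measurable Y) (hZ2 : MemLp Z 2 P)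
    (hY2 : MemLp Y 2 P) :
    jointLaw P Z Y ∈ planSet (P.map Y) ↔ IsBackwardPair P Z Y := by
  have hZY : Measurable fun ω => (Z ω, Y ω) := hZ.prodMk hY
  have hprob : IsProbabilityMeasure (jointLaw P Z Y) :=
    Measure.isProbabilityMeasure_map hZY.aemeasurable
  have hm1 : MemLp (fun p : Rd d × Rd d => p.1) 2 (jointLaw P Z Y) :=
    (memLp_map_measure_iff continuous_fst.aestronglyMeasurable hZY.aemeasurable).2 hZ2
  have hm2 : MemLp (fun p : Rd d × Rd d => p.2) 2 (jointLaw P Z Y) :=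
    (memLp_map_measure_iff continuous_snd.aestronglyMeasurable hZY.aemeasurable).2 hY2
  have hmap : (jointLaw P Z Y).map Prod.snd = P.map Y := by
    rw [jointLaw, Measure.map_map measurable_snd hZY]; rfl
  have key : (jointLaw P Z Y)[(fun p : Rd d × Rd d => p.2) |
        sigmaOf (fun p : Rd d × Rd d => p.1)] =ᵐ[jointLaw P Z Y] (fun p => p.1) ↔
      P[Y | sigmaOf Z] =ᵐ[P] Z := by
    rw [condExp_sigmaOf_eq_iff measurable_fst (hm2.integrable one_le_two)
      (hm1.integrable one_le_two), condExp_sigmaOf_eq_iff hZ (hY2.integrable one_le_two)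
      (hZ2.integrable one_le_two)]
    refine forall₂_congr fun B hB => ?_
    rw [jointLaw, setIntegral_map (measurable_fst hB) continuous_snd.aestronglyMeasurable
      hZY.aemeasurable, setIntegral_map (measurable_fst hB) continuous_fst.aestronglyMeasurable
      hZY.aemeasurable]
    rfl
  exact ⟨fun h => ⟨hZ, hY, hZ2, hY2, key.1 h.2.2.2.2⟩,
    fun h => ⟨hprob, hm1, hm2, hmap, key.2 h.condExp_eq⟩⟩

end Pairs

/-! ### Conditional laws and the projection multifunction -/

section CondLaw

variable {d : ℕ} {S : Matrix (Fin d) (Fin d) ℝ} {G : Set (Rd d)}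
  {Ω : Type*} [mΩ : MeasurableSpace Ω] {P : Measure Ω} [IsProbabilityMeasure P] {Y Z : Ω → Rd d}

/-- The conditional expectation of a selection of a random closed convex set, measurable with
respect to the conditioning, belongs to that set. -/
theorem ae_condExp_mem_of_convex {β : Type*} [mβ : MeasurableSpace β] {W : Ω → β}
    (hW : Measurable W) (hZ : Integrable Z P) {F : β → Set (Rd d)}
    (hF : MeasurableSet {p : β × Rd d | p.2 ∈ F p.1}) (hclosed : ∀ b, IsClosed (F b))
    (hconv : ∀ᵐ ω ∂P, Convex ℝ (F (W ω))) (hmem : ∀ᵐ ω ∂P, Z ω ∈ F (W ω)) :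
    ∀ᵐ ω ∂P, (P[Z | mβ.comap W]) ω ∈ F (W ω) := by
  have hZm : AEMeasurable Z P := hZ.aemeasurable
  have h1 := condExp_ae_eq_integral_condDistrib' hW hZ
  have h2 : ∀ᵐ ω ∂P, ∀ᵐ z ∂condDistrib Z W P (W ω), z ∈ F (W ω) := by
    have : ∀ᵐ p ∂(P.map W) ⊗ₘ condDistrib Z W P, p.2 ∈ F p.1 := by
      rw [compProd_map_condDistrib hZm, ae_map_iff (hW.aemeasurable.prodMk hZm) hF]
      exact hmem
    exact ae_of_ae_map hW.aemeasurable (Measure.ae_ae_of_ae_compProd this)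
  have h3 : ∀ᵐ ω ∂P, Integrable (fun z => z) (condDistrib Z W P (W ω)) :=
    Integrable.condDistrib_ae (f := fun p : β × Rd d => p.2) hW.aemeasurable hZm
      ((integrable_map_measure measurable_snd.aestronglyMeasurable
        (hW.aemeasurable.prodMk hZm)).2 hZ)
  filter_upwards [h1, h2, h3, hconv] with ω e1 e2 e3 e4
  rw [e1]
  exact e4.integral_mem (hclosed _) e2 e3

/-- The graph of the projection is measurable for the `σ`-algebra that the projection generates. -/
theorem measurableSet_graph_proj (hG : G ∈ MaxSMonotone S) :
    MeasurableSet[(sigmaProj S G).prod inferInstance] {p : Rd d × Rd d | p.2 ∈ proj S G p.1} := by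
  have h : {p : Rd d × Rd d | p.2 ∈ proj S G p.1}ᶜ =
      ⋃ B ∈ TopologicalSpace.countableBasis (Rd d),
        {y | (proj S G y ∩ B).Nonempty}ᶜ ×ˢ B := by
    ext ⟨y, x⟩
    simp only [mem_compl_iff, mem_ofPred_eq, mem_iUnion, mem_prod, exists_prop]
    constructor
    · intro hx
      obtain ⟨B, hB, hxB, hBsub⟩ :=
        (TopologicalSpace.isBasis_countableBasis (Rd d)).exists_subset_of_mem_open
          (show x ∈ (proj S G y)ᶜ from hx) (isClosed_proj hG y).isOpen_compl
      exact ⟨B, hB, fun ⟨u, hu, huB⟩ => hBsub huB hu, hxB⟩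
    · rintro ⟨B, -, hB, hxB⟩ hx
      exact hB ⟨x, hx, hxB⟩
  rw [← MeasurableSet.compl_iff, h]
  refine MeasurableSet.biUnion (TopologicalSpace.countable_countableBasis _) fun B hB => ?_
  have hBo := TopologicalSpace.isOpen_of_mem_countableBasis hB
  refine @MeasurableSet.prod _ _ (sigmaProj S G) _ _ _ ?_ hBo.measurableSet
  exact @MeasurableSet.compl _ _ (sigmaProj S G)
    (MeasurableSpace.measurableSet_generateFrom ⟨B, hBo, rfl⟩)

/-- The image of a closed set under a coordinate projection between Euclidean spaces is Borel, as
a `σ`-compact set. -/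
theorem measurableSet_image_snd_of_isClosed {A : Set (Rd d × (Rd d × Rd d))} (hA : IsClosed A) :
    MeasurableSet (Prod.snd '' A) := by
  obtain ⟨K, hK, hKA⟩ := (isSigmaCompact_univ.of_isClosed_subset hA (subset_univ A)).image
    (continuous_snd (X := Rd d) (Y := Rd d × Rd d))
  rw [← hKA]
  exact MeasurableSet.iUnion fun n => (hK n).isClosed.measurableSet

/-- The pairs `(z, y)` for which no `x ∈ P_G(z)` has `S(x - z, z - y) > 0` form a Borel set. -/
theorem measurableSet_forall_proj_le (hG : G ∈ MaxSMonotone S) :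
    MeasurableSet {p : Rd d × Rd d | ∀ x, x ∈ proj S G p.1 → sForm S (x - p.1) (p.1 - p.2) ≤ 0} := by
  have h : {p : Rd d × Rd d | ∀ x, x ∈ proj S G p.1 → sForm S (x - p.1) (p.1 - p.2) ≤ 0}ᶜ =
      ⋃ n : ℕ, Prod.snd '' {q : Rd d × (Rd d × Rd d) | q.1 ∈ proj S G q.2.1 ∧
        1 / ((n : ℝ) + 1) ≤ sForm S (q.1 - q.2.1) (q.2.1 - q.2.2)} := by
    ext p
    simp only [mem_compl_iff, mem_ofPred_eq, not_forall, not_le, mem_iUnion, mem_image,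
      Prod.exists, exists_prop]
    constructor
    · rintro ⟨x, hx, hpos⟩
      obtain ⟨n, hn⟩ := exists_nat_one_div_lt hpos
      exact ⟨n, x, p.1, p.2, ⟨hx, hn.le⟩, rfl⟩
    · rintro ⟨n, x, z, y, ⟨hx, hn⟩, rfl⟩
      exact ⟨x, hx, lt_of_lt_of_le (by positivity) hn⟩
  rw [← MeasurableSet.compl_iff, h]
  refine MeasurableSet.iUnion fun n => measurableSet_image_snd_of_isClosed ?_
  refine IsClosed.inter ?_ ?_
  · exact (isClosed_graph_proj hG).preimage
      (f := fun q : Rd d × (Rd d × Rd d) => (q.1, q.2.1)) (by fun_prop)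
  · exact isClosed_le continuous_const (continuous_sForm S (by fun_prop) (by fun_prop))

/-- If `z ∈ P_G(y)` then `S(x - z, z - y) ≥ 0` for `x ∈ P_G(z)`, and equality means that
`x ∈ P_G(y)`. -/
theorem sForm_sub_sub_eq (hS : S.IsSymm) (hG : SMonotone S G) {x y z : Rd d}
    (hzG : z ∈ G) (hx : x ∈ proj S G z) : sForm S (x - z) (z - y) =
      (sForm S z y - quad S z) - (sForm S x y - quad S x) := by
  have h := ((mem_proj_iff_of_mem hG hzG).1 hx).2
  rw [quad_sub hS] at h
  rw [sForm_sub_left, sForm_sub_right, sForm_sub_right, sForm_self]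
  linarith

/-- If the backward martingale pair satisfies `Z ∈ P_G(Y)`, then `P_G(Z) ⊆ P_G(Y)`: for
`x ∈ P_G(z)` the function `S(x - z, z - y)` of `y` is nonnegative and has zero integral under the
conditional law of `Y` given `Z = z`. -/
theorem IsBackwardPair.ae_proj_subset (h : IsBackwardPair P Z Y) (hS : S.IsSymm)
    (hG : G ∈ MaxSMonotone S) (hmem : ∀ᵐ ω ∂P, Z ω ∈ proj S G (Y ω)) :
    ∀ᵐ ω ∂P, proj S G (Z ω) ⊆ proj S G (Y ω) := by
  have hZm := h.measurable_left
  have hYm := h.measurable_right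
  have hYi := h.memLp_right.integrable one_le_two
  set κ := condDistrib Y Z P with hκ
  have hlaw : (P.map Z) ⊗ₘ κ = P.map fun ω => (Z ω, Y ω) :=
    compProd_map_condDistrib hYm.aemeasurable
  have hmean : ∀ᵐ z ∂P.map Z, ∫ y, y ∂κ z = z := by
    have hm : Measurable fun z => ∫ y, y ∂κ z :=
      (StronglyMeasurable.integral_condDistrib (f := fun p : Rd d × Rd d => p.2)
        continuous_snd.stronglyMeasurable).measurable
    rw [ae_map_iff hZm.aemeasurable (measurableSet_eq_fun hm measurable_id')]
    filter_upwards [condExp_ae_eq_integral_condDistrib' hZm hYi, h.condExp_eq] with ω h1 h2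
    exact h1.symm.trans h2
  have hint : ∀ᵐ z ∂P.map Z, Integrable (fun y => y) (κ z) :=
    Integrable.condDistrib_ae_map (f := fun p : Rd d × Rd d => p.2) hYm.aemeasurable
      ((integrable_map_measure measurable_snd.aestronglyMeasurable
        (hZm.prodMk hYm).aemeasurable).2 hYi)
  have hproj : ∀ᵐ z ∂P.map Z, ∀ᵐ y ∂κ z, z ∈ proj S G y := by
    refine Measure.ae_ae_of_ae_compProd (p := fun p : Rd d × Rd d => p.1 ∈ proj S G p.2) ?_
    rw [hlaw, ae_map_iff (hZm.prodMk hYm).aemeasurable (isClosed_graph_proj hG).measurableSet]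
    exact hmem
  have hzero : ∀ᵐ z ∂P.map Z, ∀ᵐ y ∂κ z, ∀ x, x ∈ proj S G z → sForm S (x - z) (z - y) ≤ 0 := by
    filter_upwards [hmean, hint, hproj] with z h1 h2 h3
    obtain ⟨D, hDsub, hDc, hD⟩ := (TopologicalSpace.IsSeparable.of_separableSpace
      (proj S G z)).exists_countable_dense_subset
    obtain ⟨y₀, hy₀⟩ := h3.exists
    have hzG := hy₀.1
    obtain ⟨B, hB⟩ := exists_bilin S
    have h4 : ∀ᵐ y ∂κ z, ∀ x ∈ D, sForm S (x - z) (z - y) = 0 := by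
      rw [ae_ball_iff hDc]
      intro x hx
      have hi : Integrable (fun y => sForm S (x - z) (z - y)) (κ z) := by
        simp only [← hB]
        exact (B (x - z)).integrable_comp ((integrable_const z).sub h2)
      refine (integral_eq_zero_iff_of_nonneg_ae ?_ hi).1 ?_
      · filter_upwards [h3] with y hy
        rw [sForm_sub_sub_eq hS hG.1 hzG (hDsub hx)]
        exact sub_nonneg.2 (((mem_proj_iff hS).1 hy).2 x (hDsub hx).1)
      · simp only [← hB]
        rw [(B (x - z)).integral_comp_comm (φ := fun y => z - y) ((integrable_const z).sub h2),
          integral_sub (integrable_const z) h2, h1]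
        simp
    filter_upwards [h4] with y hy x hx
    have hcl : IsClosed {x | sForm S (x - z) (z - y) ≤ 0} :=
      isClosed_le (continuous_sForm S (by fun_prop) continuous_const) continuous_const
    exact closure_minimal (fun x hx => (hy x hx).le) hcl (hD hx)
  have hall := Measure.ae_compProd_of_ae_ae (κ := κ) (measurableSet_forall_proj_le hG) hzero
  rw [hlaw] at hall
  filter_upwards [ae_of_ae_map (hZm.prodMk hYm).aemeasurable hall, hmem] with ω h1 h2 x hx
  have h3 := h1 x hx
  rw [sForm_sub_sub_eq hS hG.1 h2.1 hx] at h3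
  rw [mem_proj_iff hS] at h2 ⊢
  exact ⟨hx.1, fun z hz => (h2.2 z hz).trans (by linarith)⟩

end CondLaw

/-! ### Conditioning on the projection -/

section Conditioning

variable {d : ℕ} {S : Matrix (Fin d) (Fin d) ℝ} {G : Set (Rd d)}
  {Ω : Type*} [mΩ : MeasurableSpace Ω] {P : Measure Ω} [IsProbabilityMeasure P] {Y Z : Ω → Rd d}

/-- The function of `y` whose value at `Y` is the conditional expectation `E[Y | σ(P_G(Y))]`. -/
noncomputable def barycenter (S : Matrix (Fin d) (Fin d) ℝ) (G : Set (Rd d)) (ν : Measure (Rd d)) :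
    Rd d → Rd d :=
  ν[(fun y => y) | sigmaProj S G]

theorem measurable_barycenter (ν : Measure (Rd d)) :
    Measurable[sigmaProj S G] (barycenter S G ν) :=
  stronglyMeasurable_condExp.measurable

/-- The barycenter depends on a point through its projection only. -/
theorem barycenter_eq_of_proj_eq {ν : Measure (Rd d)} {y z : Rd d}
    (h : proj S G y = proj S G z) : barycenter S G ν y = barycenter S G ν z :=
  ((mem_iff_of_proj_eq (measurable_barycenter ν (measurableSet_singleton (barycenter S G ν y)))
    h).1 rfl).symm

theorem condExp_sigmaProjOf_eq (hG : G ∈ MaxSMonotone S) (hY : Measurable Y)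
    (hYi : Integrable Y P) :
    P[Y | sigmaProjOf S G Y] =ᵐ[P] fun ω => barycenter S G (P.map Y) (Y ω) := by
  have hm : sigmaProjOf S G Y ≤ mΩ := (sigmaProjOf_le hG Y).trans hY.comap_le
  have := Measure.isProbabilityMeasure_map (μ := P) hY.aemeasurable
  have hid : Integrable (fun y : Rd d => y) (P.map Y) :=
    (integrable_map_measure aestronglyMeasurable_id hY.aemeasurable).2 hYi
  have hb : Integrable (barycenter S G (P.map Y)) (P.map Y) := integrable_condExp
  have hbY : Integrable (fun ω => barycenter S G (P.map Y) (Y ω)) P :=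
    (integrable_map_measure hb.1 hY.aemeasurable).1 hb
  refine (ae_eq_condExp_of_forall_setIntegral_eq hm hYi (fun s _ _ => hbY.integrableOn) ?_ ?_).symm
  · rintro s ⟨B, hB, rfl⟩ -
    have hB' := sigmaProj_le hG B hB
    have h := setIntegral_condExp (sigmaProj_le hG) hid hB
    change ∫ y in B, barycenter S G (P.map Y) y ∂P.map Y = _ at h
    rw [setIntegral_map hB' hb.1 hY.aemeasurable,
      setIntegral_map hB' continuous_id'.aestronglyMeasurable hY.aemeasurable] at h
    exact h
  · exact ((measurable_barycenter _).comp
      (comap_measurable (m := sigmaProj S G) Y)).aestronglyMeasurable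

/-- If `P_G(Z) = P_G(Y)` for a backward martingale pair, then `Y` and `Z` have the same conditional
expectation given `P_G(Y)`, since the events of `σ(P_G(Y))` are events of `σ(Z)` up to null sets. -/
theorem IsBackwardPair.condExp_sigmaProjOf_eq (h : IsBackwardPair P Z Y)
    (hG : G ∈ MaxSMonotone S) (heq : ∀ᵐ ω ∂P, proj S G (Z ω) = proj S G (Y ω)) :
    P[Z | sigmaProjOf S G Y] =ᵐ[P] P[Y | sigmaProjOf S G Y] := by
  have hm : sigmaProjOf S G Y ≤ mΩ := (sigmaProjOf_le hG Y).trans h.measurable_right.comap_le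
  have hYi := h.memLp_right.integrable one_le_two
  have hZi := h.memLp_left.integrable one_le_two
  refine (ae_eq_condExp_of_forall_setIntegral_eq hm hZi
    (fun s _ _ => integrable_condExp.integrableOn) ?_
    stronglyMeasurable_condExp.aestronglyMeasurable).symm
  rintro s hs -
  rw [setIntegral_condExp hm hYi hs]
  obtain ⟨B, hB, rfl⟩ := hs
  have hYZ : (Y ⁻¹' B : Set Ω) =ᵐ[P] (Z ⁻¹' B : Set Ω) := by
    filter_upwards [heq] with ω hω
    exact propext (mem_iff_of_proj_eq hB hω.symm)
  rw [setIntegral_congr_set hYZ, setIntegral_congr_set hYZ]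
  exact (condExp_sigmaOf_eq_iff h.measurable_left hYi hZi).1 h.condExp_eq B (sigmaProj_le hG B hB)

/-- A version `X` of a conditional expectation of `W` satisfies `E[W | X] = X`. -/
theorem condExp_sigmaOf_eq_of_ae_eq_condExp {Ω : Type*} {m mΩ : MeasurableSpace Ω}
    {P : Measure Ω}
    [IsProbabilityMeasure P] (hm : m ≤ mΩ) {W X : Ω → Rd d} (hW : Integrable W P) (hX : Measurable X) (h : X =ᵐ[P] P[W | m]) :
    P[W | sigmaOf X] =ᵐ[P] X := by
  have hXi : Integrable X P := integrable_condExp.congr h.symm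
  rw [condExp_sigmaOf_eq_iff hX hW hXi]
  intro B hB
  have hpre : (X ⁻¹' B : Set Ω) =ᵐ[P] (P[W | m] ⁻¹' B : Set Ω) := by
    filter_upwards [h] with ω hω
    change (X ω ∈ B) = ((P[W | m]) ω ∈ B)
    rw [hω]
  have hmeas : MeasurableSet[m] (P[W | m] ⁻¹' B) := stronglyMeasurable_condExp.measurable hB
  rw [setIntegral_congr_set hpre, setIntegral_congr_set hpre, ← setIntegral_condExp hm hW hmeas]
  exact integral_congr_ae (ae_restrict_of_ae h.symm)

/-- For a backward martingale pair with `Z ∈ P_G(Y)`, away from `Σ₁(P_G)`, the projections of `Z`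
and `Y` agree. -/
theorem IsBackwardPair.ae_proj_eq (h : IsBackwardPair P Z Y) (hS : S.IsSymm)
    (hG : G ∈ MaxSMonotone S) (hsing : ∀ᵐ ω ∂P, Y ω ∉ singularSetOne S G)
    (hmem : ∀ᵐ ω ∂P, Z ω ∈ proj S G (Y ω)) :
    ∀ᵐ ω ∂P, proj S G (Z ω) = proj S G (Y ω) := by
  filter_upwards [h.ae_proj_subset hS hG hmem, hsing, hmem] with ω h1 h2 h3
  exact h1.antisymm (proj_subset_proj_of_mem hG.1 h2 h3)

/-- For a backward martingale pair with `Z ∈ P_G(Y)`, away from `Σ₁(P_G)`, the conditional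
expectation of `Y` given `P_G(Y)` belongs to `P_G(Y)`. -/
theorem IsBackwardPair.ae_barycenter_mem (h : IsBackwardPair P Z Y) (hS : S.IsSymm)
    (hG : G ∈ MaxSMonotone S) (hsing : ∀ᵐ ω ∂P, Y ω ∉ singularSetOne S G)
    (hmem : ∀ᵐ ω ∂P, Z ω ∈ proj S G (Y ω)) :
    ∀ᵐ ω ∂P, barycenter S G (P.map Y) (Y ω) ∈ proj S G (Y ω) := by
  have hYm : Measurable[mΩ, sigmaProj S G] Y := h.measurable_right.mono le_rfl (sigmaProj_le hG)
  have h1 := ae_condExp_mem_of_convex (mβ := sigmaProj S G) hYm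
    (h.memLp_left.integrable one_le_two) (F := proj S G) (measurableSet_graph_proj hG)
    (isClosed_proj hG) (hsing.mono fun ω hω => convex_proj hS hG hω) hmem
  filter_upwards [h1, h.condExp_sigmaProjOf_eq hG (h.ae_proj_eq hS hG hsing hmem),
    BackwardTransport.condExp_sigmaProjOf_eq hG h.measurable_right
      (h.memLp_right.integrable one_le_two)] with ω e1 e2 e3
  rw [← e3, ← e2]
  exact e1

theorem one_half_mul_integral_sForm (h : IsBackwardPair P Z Y) :
    1 / 2 * ∫ ω, sForm S (Z ω) (Y ω) ∂P = ∫ ω, quad S (Z ω) ∂P := by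
  rw [h.integral_sForm]; ring

end Conditioning

/-! ### Optimal plans and optimal maps -/

section Optimality

variable {d : ℕ} {S : Matrix (Fin d) (Fin d) ℝ} {G : Set (Rd d)}

/-- If `G` is dual optimal, then an optimal plan exists, and the optimal plans are the backward
martingale plans carried by the graph of `P_G`. -/
theorem isOptimalPlan_iff_ae_mem_proj {m : ℕ} (hS : S ∈ SymIndex d m) {ν : Measure (Rd d)}
    [IsProbabilityMeasure ν] (hν : MemLp (fun y : Rd d => y) 2 ν) (hG : IsDualOptimal S ν G) :
    (∃ γ, IsOptimalPlan S ν γ) ∧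
      ∀ γ ∈ planSet ν, IsOptimalPlan S ν γ ↔ ∀ᵐ p ∂γ, p.1 ∈ proj S G p.2 := by
  obtain ⟨γ₀, hγ₀, happ⟩ := exists_plan_forall_exists_convex_majorant S hν
  obtain ⟨r, hr, hlub, hmin⟩ := exists_integrable_isLUB hS hν hG (by
    obtain ⟨f, h1, h2, h3, -⟩ := happ 1 one_pos
    exact ⟨f, h1, h2, h3⟩)
  have hr₀ : ∫ y, r y ∂ν ≤ ∫ p, quad S p.1 ∂γ₀ := le_of_forall_pos_le_add fun ε hε => by
    obtain ⟨f, h1, h2, h3, h4⟩ := happ ε hε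
    exact (hmin f h1 h2 h3).trans h4
  -- the comparison of a plan with the dual value `∫ r dν`
  have hplan : ∀ γ ∈ planSet ν,
      1 / 2 * ∫ p, sForm S p.1 p.2 ∂γ ≤ ∫ y, r y ∂ν ∧
      (∫ y, r y ∂ν ≤ 1 / 2 * ∫ p, sForm S p.1 p.2 ∂γ ↔ ∀ᵐ p ∂γ, p.1 ∈ proj S G p.2) := by
    intro γ hγ
    have := hγ.1
    have hpair := isBackwardPair_of_mem_planSet hγ
    have hmap := hγ.2.2.2.1
    have hri : Integrable (fun p : Rd d × Rd d => r p.2) γ :=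
      (integrable_map_measure (by rw [hmap]; exact hr.1) measurable_snd.aemeasurable).1
        (by rw [hmap]; exact hr)
    have hrint : ∫ p, r p.2 ∂γ = ∫ y, r y ∂ν := by
      rw [← integral_map (φ := Prod.snd) measurable_snd.aemeasurable (by rw [hmap]; exact hr.1),
        hmap]
    have hlubγ : ∀ᵐ p ∂γ, IsLUB ((fun z => sForm S z p.2 - quad S z) '' G) (r p.2) :=
      ae_of_ae_map (f := Prod.snd) measurable_snd.aemeasurable (by rw [hmap]; exact hlub)
    have hubγ : ∀ᵐ p ∂γ, ∀ z ∈ G, sForm S z p.2 - quad S z ≤ r p.2 :=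
      hlubγ.mono fun p hp z hz => hp.1 ⟨z, hz, rfl⟩
    rw [one_half_mul_integral_sForm hpair, ← hrint]
    exact ⟨hpair.integral_quad_le hS.1 hG.1 hri hubγ,
      hpair.ae_mem_proj hS.1 hG.1 hri hubγ, fun h => (hpair.integral_quad_eq hS.1 hlubγ h).ge⟩
  have hval₀ : ∫ y, r y ∂ν ≤ 1 / 2 * ∫ p, sForm S p.1 p.2 ∂γ₀ := by
    have := hγ₀.1
    rwa [one_half_mul_integral_sForm (isBackwardPair_of_mem_planSet hγ₀)]
  refine ⟨⟨γ₀, hγ₀, fun γ hγ => (hplan γ hγ).1.trans hval₀⟩, fun γ hγ => ⟨fun h => ?_, fun h => ?_⟩⟩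
  · exact (hplan γ hγ).2.1 (hval₀.trans (h.2 γ₀ hγ₀))
  · exact ⟨hγ, fun γ' hγ' => (hplan γ' hγ').1.trans ((hplan γ hγ).2.2 h)⟩

variable {Ω : Type*} [MeasurableSpace Ω] {P : Measure Ω} {Y Z : Ω → Rd d}

theorem integral_sForm_jointLaw (hZ : Measurable Z) (hY : Measurable Y) :
    ∫ p, sForm S p.1 p.2 ∂jointLaw P Z Y = ∫ ω, sForm S (Z ω) (Y ω) ∂P :=
  integral_map (hZ.prodMk hY).aemeasurable
    (continuous_sForm S continuous_fst continuous_snd).aestronglyMeasurable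

theorem ae_jointLaw_mem_proj_iff (hG : G ∈ MaxSMonotone S) (hZ : Measurable Z)
    (hY : Measurable Y) :
    (∀ᵐ p ∂jointLaw P Z Y, p.1 ∈ proj S G p.2) ↔ ∀ᵐ ω ∂P, Z ω ∈ proj S G (Y ω) :=
  ae_map_iff (hZ.prodMk hY).aemeasurable (isClosed_graph_proj hG).measurableSet

theorem isBackwardPair_of_mem_mapSet (hY : IsL2 P Y) (hZ : Z ∈ mapSet P Y) :
    IsBackwardPair P Z Y :=
  ⟨hZ.1.1, hY.1, hZ.1.2, hY.2, hZ.2.2⟩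

/-- For dual optimal `G` with `ν(Σ₁(P_G)) = 0`, the barycenter is a selection of `P_G`. -/
theorem ae_barycenter_mem_proj {m : ℕ} (hS : S ∈ SymIndex d m) {ν : Measure (Rd d)}
    [IsProbabilityMeasure ν] (hν : MemLp (fun y : Rd d => y) 2 ν) (hG : IsDualOptimal S ν G)
    (hsing : ν (singularSetOne S G) = 0) : ∀ᵐ y ∂ν, barycenter S G ν y ∈ proj S G y := by
  obtain ⟨⟨γ, hγ⟩, hiff⟩ := isOptimalPlan_iff_ae_mem_proj hS hν hG
  have := hγ.1.1
  have hmap := hγ.1.2.2.2.1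
  have hsingγ : ∀ᵐ p ∂γ, p.2 ∉ singularSetOne S G :=
    ae_of_ae_map (f := Prod.snd) (p := fun y => y ∉ singularSetOne S G)
      measurable_snd.aemeasurable
      (by rw [hmap]; exact measure_eq_zero_iff_ae_notMem.1 hsing)
  have h := (isBackwardPair_of_mem_planSet hγ.1).ae_barycenter_mem hS.1 hG.1 hsingγ
    ((hiff γ hγ.1).1 hγ)
  have hb : Measurable (barycenter S G ν) :=
    (measurable_barycenter ν).mono (sigmaProj_le hG.1) le_rfl
  have hset : MeasurableSet {y | barycenter S G ν y ∈ proj S G y} :=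
    (hb.prodMk measurable_id) (isClosed_graph_proj hG.1).measurableSet
  rw [hmap] at h
  rw [← hmap, ae_map_iff measurable_snd.aemeasurable (by rw [hmap]; exact hset), hmap]
  exact h

end Optimality

end BackwardTransport

open BackwardTransport in
theorem theorem3 {d m : ℕ} (S : Matrix (Fin d) (Fin d) ℝ)
    (hS : S ∈ BackwardTransport.SymIndex d m)
    {Ω : Type*} [MeasurableSpace Ω] (P : Measure Ω) [IsProbabilityMeasure P]
    (Y : Ω → BackwardTransport.Rd d) (hY : BackwardTransport.IsL2 P Y)
    (G : Set (BackwardTransport.Rd d))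
    (hG : BackwardTransport.IsDualOptimal S (P.map Y) G)
    (hsing : (P.map Y) (BackwardTransport.singularSetOne S G) = 0)
    (X : Ω → BackwardTransport.Rd d) (hXm : Measurable X)
    (hX : X =ᵐ[P] P[Y | BackwardTransport.sigmaProjOf S G Y]) :
    BackwardTransport.IsOptimalMap S P Y X ∧
    BackwardTransport.IsOptimalPlan S (P.map Y) (BackwardTransport.jointLaw P X Y) ∧
    ∀ Z : Ω → BackwardTransport.Rd d, BackwardTransport.IsL2 P Z →
      (BackwardTransport.IsOptimalMap S P Y Z →
        BackwardTransport.IsOptimalPlan S (P.map Y) (BackwardTransport.jointLaw P Z Y)) ∧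
      (BackwardTransport.IsOptimalPlan S (P.map Y) (BackwardTransport.jointLaw P Z Y) →
        (∀ᵐ ω ∂P, Z ω ∈ BackwardTransport.proj S G (Z ω) ∧
          BackwardTransport.proj S G (Z ω) = BackwardTransport.proj S G (Y ω)) ∧
        BackwardTransport.IsMeasurableWrt P X Z ∧
        X =ᵐ[P] P[Z | BackwardTransport.sigmaOf X] ∧
        (∀ᵐ ω ∂P, BackwardTransport.sForm S (Z ω - X ω) (Z ω - X ω) = 0)) := by
  have hsymm := hS.1
  have hGmax := hG.1
  have hYm := hY.1
  have hYi := hY.2.integrable one_le_two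
  have hν : IsProbabilityMeasure (P.map Y) := Measure.isProbabilityMeasure_map hYm.aemeasurable
  have hν2 : MemLp (fun y : Rd d => y) 2 (P.map Y) :=
    (memLp_map_measure_iff aestronglyMeasurable_id hYm.aemeasurable).2 hY.2
  have hm := (sigmaProjOf_le hGmax Y).trans hYm.comap_le
  have hb : Measurable (barycenter S G (P.map Y)) :=
    (measurable_barycenter _).mono (sigmaProj_le hGmax) le_rfl
  have hsingP : ∀ᵐ ω ∂P, Y ω ∉ singularSetOne S G :=
    ae_of_ae_map hYm.aemeasurable (measure_eq_zero_iff_ae_notMem.1 hsing)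
  obtain ⟨-, hiff⟩ := isOptimalPlan_iff_ae_mem_proj hS hν2 hG
  have hXb : X =ᵐ[P] fun ω => barycenter S G (P.map Y) (Y ω) :=
    hX.trans (condExp_sigmaProjOf_eq hGmax hYm hYi)
  have hXproj : ∀ᵐ ω ∂P, X ω ∈ proj S G (Y ω) := by
    filter_upwards [hXb, ae_of_ae_map hYm.aemeasurable
      (ae_barycenter_mem_proj hS hν2 hG hsing)] with ω h1 h2
    rwa [h1]
  have hX2 : MemLp X 2 P := (memLp_congr_ae hX).2 (hY.2.condExp one_le_two)
  have hXY : IsBackwardPair P X Y :=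
    ⟨hXm, hYm, hX2, hY.2, condExp_sigmaOf_eq_of_ae_eq_condExp hm hYi hXm hX⟩
  have hXmap : X ∈ mapSet P Y := ⟨⟨hXm, hX2⟩, ⟨_, hb, hXb⟩, hXY.condExp_eq⟩
  have hXplan : IsOptimalPlan S (P.map Y) (jointLaw P X Y) :=
    (hiff _ ((jointLaw_mem_planSet_iff hXm hYm hX2 hY.2).2 hXY)).2
      ((ae_jointLaw_mem_proj_iff hGmax hXm hYm).2 hXproj)
  have hplan : ∀ Z ∈ mapSet P Y, jointLaw P Z Y ∈ planSet (P.map Y) := fun Z hZ =>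
    (jointLaw_mem_planSet_iff hZ.1.1 hYm hZ.1.2 hY.2).2 (isBackwardPair_of_mem_mapSet hY hZ)
  refine ⟨⟨hXmap, fun Z hZ => ?_⟩, hXplan,
    fun Z hZ => ⟨fun hopt => ⟨hplan Z hopt.1, ?_⟩, fun hopt => ?_⟩⟩
  · have := hXplan.2 _ (hplan Z hZ)
    rwa [integral_sForm_jointLaw hZ.1.1 hYm, integral_sForm_jointLaw hXm hYm] at this
  · intro γ hγ
    refine (hXplan.2 γ hγ).trans ?_
    rw [integral_sForm_jointLaw hXm hYm, integral_sForm_jointLaw hZ.1 hYm]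
    exact hopt.2 X hXmap
  · have hZY : IsBackwardPair P Z Y := (jointLaw_mem_planSet_iff hZ.1 hYm hZ.2 hY.2).1 hopt.1
    have hZproj : ∀ᵐ ω ∂P, Z ω ∈ proj S G (Y ω) :=
      (ae_jointLaw_mem_proj_iff hGmax hZ.1 hYm).1 ((hiff _ hopt.1).1 hopt)
    have heq := hZY.ae_proj_eq hsymm hGmax hsingP hZproj
    refine ⟨?_, ⟨_, hb, ?_⟩, ?_, ?_⟩
    · filter_upwards [heq, hZproj] with ω h1 h2
      exact ⟨h1 ▸ h2, h1⟩
    · filter_upwards [hXb, heq] with ω h1 h2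
      rw [h1, barycenter_eq_of_proj_eq h2]
    · exact (condExp_sigmaOf_eq_of_ae_eq_condExp hm (hZ.2.integrable one_le_two) hXm
        (hX.trans (hZY.condExp_sigmaProjOf_eq hGmax heq).symm)).symm
    · filter_upwards [hXproj, hZproj, hsingP] with ω h1 h2 h3
      rw [sForm_self, quad_sub_eq_zero_of_notMem_singularSetOne hGmax.1 h3 h2 h1, mul_zero]
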